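/- Let $\mu,M>0$ and consider the spatial Kepler problem of a particle of mass $\mu$ attracted by a fixed centre of mass $M$ (gravitational constant $1$): on the phase space $\{(P,Q)\in\mathbb R^3\times\mathbb R^3: Q\neq 0\}$ with symplectic form $\omega=\sum_{j=1}^3 dP^j\wedge dQ^j$, the energy is $K=\frac{\|P\|^2}{2\mu}-\frac{\mu M}{\|Q\|}$. Let $\mathcal E=\{Q\ne0,\ K<0\}$ be the set of elliptic states. A state in $\mathcal E$ has semi-major axis $a=-\mu M/(2K)$, angular momentum $\vec C=Q\times P$, eccentricity vector $\vec e=\frac{P\times \vec C}{\mu^2M}-\frac{Q}{\|Q\|}$ (pointing to the pericentre) and eccentricity $e=\|\vec e\|$; when $\vec C\ne0$, its inclination $i\in[0,\pi]$ is the angle between $\vec C$ and the vertical $(0,0,1)$. Let $\mathcal D\subset\mathcal E$ be the set of states whose ellipse is neither rectilinear ($\vec C=0$), nor circular ($e=0$), nor horizontal ($i\in\{0,\pi\}$). The Delaunay variables on $\mathcal D$ are $$L=\mu\sqrt M\sqrt a,\qquad G=L\sqrt{1-e^2},\qquad H=G\cos i,$$ and the angles modulo $2\pi$: $l=u-e\sin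 u$, the mean anomaly, where $u$ is the eccentric anomaly (in the orbital plane oriented by $\vec C$, in the orthonormal frame whose first vector is directed to the pericentre, $Q=(a(\cos u-e),\,a\sqrt{1-e^2}\sin u)$); $g$, the argument of the pericentre, i.e. the angle from the ascending node to the pericentre in the orbital plane oriented by $\vec C$; and $h$, the longitude of the ascending node, i.e. the angle from the first coordinate axis to the direction $(0,0,1)\times\vec C$ of the ascending node in the horizontal plane. Then $\mathcal D$ is an open subset of the phase space, contained and dense in $\mathcal E$, and $(L,l,G,g,H,h)$ are Darboux coordinates on $\mathcal D$: the map $(L,l,G,g,H,h):\mathcal D\to(\mathbb R\times\mathbb R/2\pi\mathbb Z)^3$ is injective, and every point of $\mathcal D$ has an open neighbourhood $U\subset\mathcal D$ on which $l,g,h$ have real-valued determinations such that $(L,l,G,g,H,h)$ is a smooth diffeomorphism from $U$ onto an open subset of $\mathbb R^6$, and on $U$ $$\omega=dL\wedge dl+dG\wedge dg+dH\wedge dh .$$ -/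

import Mathlib

open scoped ContDiff

noncomputable section

namespace Delaunay

/-- Physical space, with its Euclidean norm. -/
abbrev Space : Type := EuclideanSpace ℝ (Fin 3)

/-- Pairs `x = (P, Q)` of a momentum `P = x.1` and a position `Q = x.2`. -/
abbrev Phase : Type := Space × Space

/-- The cross product of Euclidean three-space. -/
def cross (u v : Space) : Space := WithLp.toLp 2 (crossProduct u.ofLp v.ofLp)

/-- The upward vertical unit vector; the horizontal reference plane is its orthogonal. -/
def vertical : Space := !₂[0, 0, 1]

/-- Wedge product of two covectors, evaluated at two vectors. -/
def wedge {V : Type*} [NormedAddCommGroup V] [NormedSpace ℝ V] (α β : V →L[ℝ] ℝ) (u v : V) : ℝ :=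
  α u * β v - α v * β u

/-- The standard symplectic form `∑ dP^j ∧ dQ^j` (it is constant on the linear space `Phase`). -/
def omega (u v : Phase) : ℝ := ∑ j : Fin 3, (u.1 j * v.2 j - v.1 j * u.2 j)

section Elements

variable (μ M : ℝ)

/-- Energy of a particle of mass `μ` attracted by a fixed centre of mass `M`
(gravitational constant `1`). -/
def energy (x : Phase) : ℝ := ‖x.1‖ ^ 2 / (2 * μ) - μ * M / ‖x.2‖

/-- Angular momentum vector `Q × P`. -/
def angMom (x : Phase) : Space := cross x.2 x.1

/-- The elliptic region of phase space: no collision, negative energy. -/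
def elliptic : Set Phase := {x | x.2 ≠ 0 ∧ energy μ M x < 0}

/-- Semi-major axis, from `energy = - μ M / (2 a)`. -/
def semiMajor (x : Phase) : ℝ := -(μ * M) / (2 * energy μ M x)

/-- Eccentricity (Laplace-Runge-Lenz) vector `Q̇ × (Q × Q̇) / M - Q / ‖Q‖`, where `P = μ Q̇`:
it points to the pericentre and its length is the eccentricity. -/
def eccVec (x : Phase) : Space :=
  (μ ^ 2 * M)⁻¹ • cross x.1 (angMom x) - ‖x.2‖⁻¹ • x.2

/-- Eccentricity. -/
def ecc (x : Phase) : ℝ := ‖eccVec μ M x‖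

/-- Inclination: the angle in `[0, π]` between the angular momentum and the vertical. -/
def inclination (x : Phase) : ℝ := InnerProductGeometry.angle (angMom x) vertical

/-- A vector directing the line of nodes towards the ascending node. -/
def nodeVec (x : Phase) : Space := cross vertical (angMom x)

/-- Unit normal of the orbital plane, orienting it in the sense of the motion. -/
def normalDir (x : Phase) : Space := ‖angMom x‖⁻¹ • angMom x

/-- Unit vector towards the pericentre. -/
def periDir (x : Phase) : Space := ‖eccVec μ M x‖⁻¹ • eccVec μ M x

/-- Eccentric anomaly `u`: in the orthonormal frame of the orbital plane given by the pericentre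
direction and its rotation by a positive right angle, the position is
`(a (cos u - e), a √(1 - e²) sin u)`. -/
def eccAnomaly (x : Phase) : Real.Angle :=
  (Complex.arg
    ⟨inner ℝ x.2 (periDir μ M x) / semiMajor μ M x + ecc μ M x,
      inner ℝ x.2 (cross (normalDir x) (periDir μ M x)) /
        (semiMajor μ M x * √(1 - ecc μ M x ^ 2))⟩ : ℝ)

/-- Circular angular momentum. -/
def varL (x : Phase) : ℝ := μ * √M * √(semiMajor μ M x)

/-- Mean anomaly, by Kepler's equation `l = u - e sin u`. -/
def varl (x : Phase) : Real.Angle :=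
  eccAnomaly μ M x - ((ecc μ M x * (eccAnomaly μ M x).sin : ℝ) : Real.Angle)

/-- Angular momentum. -/
def varG (x : Phase) : ℝ := varL μ M x * √(1 - ecc μ M x ^ 2)

/-- Argument of the pericentre: the angle from the ascending node to the pericentre, in the
orbital plane oriented by the motion. -/
def varg (x : Phase) : Real.Angle :=
  (Complex.arg
    ⟨inner ℝ (eccVec μ M x) (nodeVec x),
      inner ℝ (eccVec μ M x) (cross (normalDir x) (nodeVec x))⟩ : ℝ)

/-- Vertical component of the angular momentum. -/
def varH (x : Phase) : ℝ := varG μ M x * Real.cos (inclination x)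

/-- Longitude of the ascending node: the angle from the first axis to the ascending node, in the
horizontal plane. -/
def varh (x : Phase) : Real.Angle := (Complex.arg ⟨nodeVec x 0, nodeVec x 1⟩ : ℝ)

/-- The six Delaunay variables `(L, l, G, g, H, h)`, the angles being taken modulo `2 π`. -/
def coords (x : Phase) : ℝ × Real.Angle × ℝ × Real.Angle × ℝ × Real.Angle :=
  (varL μ M x, varl μ M x, varG μ M x, varg μ M x, varH μ M x, varh x)

/-- The set where all the Delaunay variables are defined: the osculating conic is an ellipse which
is neither rectilinear, nor circular, nor horizontal. -/
def domain : Set Phase :=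
  {x | x ∈ elliptic μ M ∧ angMom x ≠ 0 ∧ ecc μ M x ≠ 0 ∧
    inclination x ≠ 0 ∧ inclination x ≠ Real.pi}

end Elements

/-- `f` is a smooth chart on the open set `U`: it restricts to a smooth diffeomorphism from `U`
to an open set. -/
def IsSmoothChart {V W : Type*} [NormedAddCommGroup V] [NormedSpace ℝ V]
    [NormedAddCommGroup W] [NormedSpace ℝ W] (f : V → W) (U : Set V) : Prop :=
  ∃ φ : OpenPartialHomeomorph V W, φ.source = U ∧ Set.EqOn φ f U ∧
    ContDiffOn ℝ ∞ φ φ.source ∧ ContDiffOn ℝ ∞ φ.symm φ.target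

/-- On the open set `U`, the real functions `l, g, h` are determinations of the angles
`varl, varg, varh`, together with `L, G, H` they are a smooth chart on `U`, and
`ω = dL ∧ dl + dG ∧ dg + dH ∧ dh` on `U`. -/
structure IsDarbouxOn (μ M : ℝ) (U : Set Phase) (l g h : Phase → ℝ) : Prop where
  lift_l : ∀ y ∈ U, (l y : Real.Angle) = varl μ M y
  lift_g : ∀ y ∈ U, (g y : Real.Angle) = varg μ M y
  lift_h : ∀ y ∈ U, (h y : Real.Angle) = varh y
  chart : IsSmoothChart
    (fun y => ![varL μ M y, l y, varG μ M y, g y, varH μ M y, h y]) U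
  form : ∀ y ∈ U, ∀ u v : Phase,
    omega u v =
      wedge (fderiv ℝ (varL μ M) y) (fderiv ℝ l y) u v +
      wedge (fderiv ℝ (varG μ M) y) (fderiv ℝ g y) u v +
      wedge (fderiv ℝ (varH μ M) y) (fderiv ℝ h y) u v

end Delaunay

end

open scoped ContDiff

noncomputable section

namespace Delaunay

/-! Everything rests on reconstructing the state from its elements. In the orthonormal frame of
Euler angles `h`, `i`, `g` (pericentre direction, its rotation by a right angle, orbital normal),
position and momentum have planar coordinates q₁, q₂, p₁, p₂ that are explicit functions of `L`,
`e`, `u` (`pos_eq`, `mom_eq_frame`). Since `L`, `G`, `H` determine `e` and `i`, and Kepler's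
equation determines `u` from `l`, the coordinates are injective.

For the symplectic form, these formulas are differentiated in the moving frame (`tangent_eq`), which
turns about its normal at the rate φ = dg + cos i dh. The planar coordinates alone contribute dL ∧
dl (`planar_form`). As G = q₁p₂ - q₂p₁ (`angular_momentum_planar`), the turning contributes dG ∧ φ,
and the normal components contribute -G sin i di ∧ dh. With H = G cos i, these last two add up to dG
∧ dg + dH ∧ dh (`omega_eq_wedge`).

No Jacobian is needed for the charts: a vector killed by the six differentials is ω-orthogonal to
every vector, hence zero, and the inverse function theorem applies (`exists_isSmoothChart`).

The domain is cut out of the elliptic states by two nonvanishing vectors, the node and the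
eccentricity vector. This gives openness by continuity, and density by perturbing the momentum at
fixed position. -/

/-! ### Vector algebra, inclination and the node vector -/

@[simp] lemma cross_zero (u v : Space) : cross u v 0 = u 1 * v 2 - u 2 * v 1 := by
  simp [cross, cross_apply]

@[simp] lemma cross_one (u v : Space) : cross u v 1 = u 2 * v 0 - u 0 * v 2 := by
  simp [cross, cross_apply]

@[simp] lemma cross_two (u v : Space) : cross u v 2 = u 0 * v 1 - u 1 * v 0 := by
  simp [cross, cross_apply]

lemma inner_coord (u v : Space) : inner ℝ u v = u 0 * v 0 + u 1 * v 1 + u 2 * v 2 := by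
  simp [PiLp.inner_apply, Fin.sum_univ_three, mul_comm]

lemma norm_sq_coord (u : Space) : ‖u‖ ^ 2 = u 0 ^ 2 + u 1 ^ 2 + u 2 ^ 2 := by
  rw [EuclideanSpace.real_norm_sq_eq, Fin.sum_univ_three]

lemma space_ext {u v : Space} (h0 : u 0 = v 0) (h1 : u 1 = v 1) (h2 : u 2 = v 2) : u = v := by
  ext j; fin_cases j <;> assumption

lemma space_eq_zero_iff (u : Space) : u = 0 ↔ u 0 = 0 ∧ u 1 = 0 ∧ u 2 = 0 := by
  constructor
  · rintro rfl; simp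
  · rintro ⟨h0, h1, h2⟩; exact space_ext (by simpa) (by simpa) (by simpa)

@[simp] lemma vertical_zero : vertical 0 = 0 := by simp [vertical]
@[simp] lemma vertical_one : vertical 1 = 0 := by simp [vertical]
@[simp] lemma vertical_two : vertical 2 = 1 := by simp [vertical]

@[simp] lemma nodeVec_zero (x : Phase) : nodeVec x 0 = -angMom x 1 := by simp [nodeVec]
@[simp] lemma nodeVec_one (x : Phase) : nodeVec x 1 = angMom x 0 := by simp [nodeVec]
@[simp] lemma nodeVec_two (x : Phase) : nodeVec x 2 = 0 := by simp [nodeVec]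

lemma norm_vertical : ‖vertical‖ = 1 := by
  have h : ‖vertical‖ ^ 2 = 1 := by rw [norm_sq_coord]; simp
  exact (pow_eq_one_iff_of_nonneg (norm_nonneg _) two_ne_zero).1 h

lemma cos_inclination (x : Phase) : Real.cos (inclination x) = angMom x 2 / ‖angMom x‖ := by
  rw [inclination, InnerProductGeometry.cos_angle, inner_coord, norm_vertical]
  simp

lemma angMom_ne_zero_of_nodeVec {x : Phase} (h : nodeVec x ≠ 0) : angMom x ≠ 0 := by
  intro h0
  exact h (by rw [nodeVec, h0]; exact space_ext (by simp) (by simp) (by simp))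

lemma inclination_mem (x : Phase) : 0 ≤ inclination x ∧ inclination x ≤ Real.pi :=
  ⟨InnerProductGeometry.angle_nonneg _ _, InnerProductGeometry.angle_le_pi _ _⟩

lemma norm_angMom_mul_cos (x : Phase) (h : angMom x ≠ 0) :
    ‖angMom x‖ * Real.cos (inclination x) = angMom x 2 := by
  rw [cos_inclination, mul_div_cancel₀ _ (norm_ne_zero_iff.2 h)]

lemma sin_inclination_nonneg (x : Phase) : 0 ≤ Real.sin (inclination x) :=
  Real.sin_nonneg_of_nonneg_of_le_pi (inclination_mem x).1 (inclination_mem x).2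

lemma norm_nodeVec (x : Phase) (h : angMom x ≠ 0) :
    ‖nodeVec x‖ = ‖angMom x‖ * Real.sin (inclination x) := by
  rw [← sq_eq_sq₀ (norm_nonneg _) (mul_nonneg (norm_nonneg _) (sin_inclination_nonneg x)),
    mul_pow, Real.sin_sq, mul_sub, mul_one, ← mul_pow, norm_angMom_mul_cos x h, norm_sq_coord,
    norm_sq_coord]
  simp
  ring

/-- The domain is cut out of the elliptic region by two nonvanishing vectors. -/
lemma mem_domain_iff {μ M : ℝ} {x : Phase} :
    x ∈ domain μ M ↔
      x.2 ≠ 0 ∧ energy μ M x < 0 ∧ nodeVec x ≠ 0 ∧ eccVec μ M x ≠ 0 := by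
  -- The node vector has length ‖C‖ sin i, so for C ≠ 0 it vanishes exactly when i is 0 or π.
  have key : ∀ h : angMom x ≠ 0,
      (inclination x ≠ 0 ∧ inclination x ≠ Real.pi ↔ nodeVec x ≠ 0) := by
    intro h
    rw [← norm_ne_zero_iff (a := nodeVec x), norm_nodeVec x h, mul_ne_zero_iff, ← not_or]
    simp only [ne_eq, norm_eq_zero, h, not_false_eq_true, true_and, not_iff_not]
    constructor
    · rintro (h | h) <;> simp [h]
    · intro hs
      by_contra! hc
      have := Real.sin_pos_of_pos_of_lt_pi (lt_of_le_of_ne (inclination_mem x).1 (Ne.symm hc.1))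
        (lt_of_le_of_ne (inclination_mem x).2 hc.2)
      exact this.ne' hs
  simp only [domain, elliptic, ecc, Set.mem_ofPred_eq, norm_ne_zero_iff]
  constructor
  · rintro ⟨⟨h1, h2⟩, h3, h4, h5⟩
    exact ⟨h1, h2, (key h3).1 h5, h4⟩
  · rintro ⟨h1, h2, h3, h4⟩
    have h := angMom_ne_zero_of_nodeVec h3
    exact ⟨⟨h1, h2⟩, h, h4, (key h).2 h3⟩

/-! ### Energy, angular momentum and eccentricity -/

section Kepler

variable {μ M : ℝ} {x : Phase}

lemma inner_pos_angMom (x : Phase) : inner ℝ x.2 (angMom x) = 0 := by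
  simp only [inner_coord, angMom, cross_zero, cross_one, cross_two]; ring

lemma inner_mom_angMom (x : Phase) : inner ℝ x.1 (angMom x) = 0 := by
  simp only [inner_coord, angMom, cross_zero, cross_one, cross_two]; ring

lemma inner_cross_left (u v : Space) : inner ℝ (cross u v) v = 0 := by
  simp only [inner_coord, cross_zero, cross_one, cross_two]; ring

lemma norm_cross_sq (u v : Space) :
    ‖cross u v‖ ^ 2 = ‖u‖ ^ 2 * ‖v‖ ^ 2 - inner ℝ u v ^ 2 := by
  simp only [norm_sq_coord, inner_coord, cross_zero, cross_one, cross_two]; ring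

lemma cross_cross (u v : Space) :
    cross v (cross u v) = ‖v‖ ^ 2 • u - (inner ℝ u v : ℝ) • v := by
  apply space_ext <;> simp [norm_sq_coord, inner_coord] <;> ring

lemma inner_cross_mom_pos (x : Phase) :
    inner ℝ (cross x.1 (angMom x)) x.2 = ‖angMom x‖ ^ 2 := by
  simp only [norm_sq_coord, inner_coord, angMom, cross_zero, cross_one, cross_two]; ring

lemma inner_eccVec_angMom (μ M : ℝ) (x : Phase) : inner ℝ (eccVec μ M x) (angMom x) = 0 := by
  rw [eccVec, inner_sub_left, inner_smul_left, inner_smul_left, inner_cross_left,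
    inner_pos_angMom]
  simp

/-- Source of the focal equation of the orbit: (P × C) · Q is the triple product ‖C‖². -/
lemma inner_eccVec_pos (μ M : ℝ) (hx : x.2 ≠ 0) :
    inner ℝ (eccVec μ M x) x.2 = (μ ^ 2 * M)⁻¹ * ‖angMom x‖ ^ 2 - ‖x.2‖ := by
  rw [eccVec, inner_sub_left, inner_smul_left, inner_smul_left, inner_cross_mom_pos,
    real_inner_self_eq_norm_sq]
  have := norm_ne_zero_iff.2 hx
  simp
  field_simp

lemma energy_neg_of_mem (hx : x ∈ domain μ M) : energy μ M x < 0 := (mem_domain_iff.1 hx).2.1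
lemma pos_ne_zero_of_mem (hx : x ∈ domain μ M) : x.2 ≠ 0 := (mem_domain_iff.1 hx).1
lemma nodeVec_ne_zero_of_mem (hx : x ∈ domain μ M) : nodeVec x ≠ 0 := (mem_domain_iff.1 hx).2.2.1
lemma eccVec_ne_zero_of_mem (hx : x ∈ domain μ M) : eccVec μ M x ≠ 0 :=
  (mem_domain_iff.1 hx).2.2.2
lemma angMom_ne_zero_of_mem (hx : x ∈ domain μ M) : angMom x ≠ 0 :=
  angMom_ne_zero_of_nodeVec (nodeVec_ne_zero_of_mem hx)
lemma norm_angMom_pos_of_mem (hx : x ∈ domain μ M) : 0 < ‖angMom x‖ :=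
  norm_pos_iff.2 (angMom_ne_zero_of_mem hx)
lemma ecc_pos_of_mem (hx : x ∈ domain μ M) : 0 < ecc μ M x :=
  norm_pos_iff.2 (eccVec_ne_zero_of_mem hx)

lemma semiMajor_pos (hμ : 0 < μ) (hM : 0 < M) (hx : x ∈ domain μ M) : 0 < semiMajor μ M x :=
  div_pos_of_neg_of_neg (neg_neg_of_pos (mul_pos hμ hM))
    (mul_neg_of_pos_of_neg two_pos (energy_neg_of_mem hx))

/-- P ⊥ C gives ‖P × C‖ = ‖P‖ ‖C‖, and the mixed term involves (P × C) · Q = ‖C‖²; what multiplies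
‖C‖² is then proportional to the energy. -/
lemma ecc_sq_eq (hμ : 0 < μ) (hM : 0 < M) (hx : x.2 ≠ 0) :
    ecc μ M x ^ 2 = 1 + 2 * energy μ M x * ‖angMom x‖ ^ 2 / (μ ^ 3 * M ^ 2) := by
  rw [ecc, eccVec, norm_sub_sq_real, norm_smul, norm_smul, mul_pow, mul_pow, inner_smul_left,
    inner_smul_right, inner_cross_mom_pos, norm_cross_sq, inner_mom_angMom, energy]
  have := norm_ne_zero_iff.2 hx
  simp [abs_of_pos hM]
  field_simp
  ring

lemma norm_angMom_sq_eq (hμ : 0 < μ) (hM : 0 < M) (hx : x ∈ domain μ M) :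
    ‖angMom x‖ ^ 2 = μ ^ 2 * M * semiMajor μ M x * (1 - ecc μ M x ^ 2) := by
  have := (energy_neg_of_mem hx).ne
  rw [ecc_sq_eq hμ hM (pos_ne_zero_of_mem hx), semiMajor]
  field_simp
  ring

lemma one_sub_ecc_sq_pos (hμ : 0 < μ) (hM : 0 < M) (hx : x ∈ domain μ M) :
    0 < 1 - ecc μ M x ^ 2 := by
  have h1 := norm_angMom_sq_eq hμ hM hx
  have h2 := semiMajor_pos hμ hM hx
  have h3 : 0 < ‖angMom x‖ ^ 2 := pow_pos (norm_angMom_pos_of_mem hx) 2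
  rw [h1] at h3
  exact (pos_iff_pos_of_mul_pos h3).1 (by positivity)

lemma ecc_lt_one (hμ : 0 < μ) (hM : 0 < M) (hx : x ∈ domain μ M) : ecc μ M x < 1 := by
  have := one_sub_ecc_sq_pos hμ hM hx
  nlinarith [ecc_pos_of_mem hx]

lemma varL_pos (hμ : 0 < μ) (hM : 0 < M) (hx : x ∈ domain μ M) : 0 < varL μ M x := by
  have := semiMajor_pos hμ hM hx
  unfold varL
  positivity

lemma varL_sq (hμ : 0 < μ) (hM : 0 < M) (hx : x ∈ domain μ M) :
    varL μ M x ^ 2 = μ ^ 2 * M * semiMajor μ M x := by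
  rw [varL, mul_pow, mul_pow, Real.sq_sqrt hM.le, Real.sq_sqrt (semiMajor_pos hμ hM hx).le]

lemma varG_eq (hμ : 0 < μ) (hM : 0 < M) (hx : x ∈ domain μ M) : varG μ M x = ‖angMom x‖ := by
  have h := varL_pos hμ hM hx
  rw [← sq_eq_sq₀ (by unfold varG; positivity) (norm_nonneg _), norm_angMom_sq_eq hμ hM hx, varG,
    mul_pow, Real.sq_sqrt (one_sub_ecc_sq_pos hμ hM hx).le, varL_sq hμ hM hx]

/-- As P ⊥ C, crossing C with P × C returns ‖C‖² P, and P × C is read off from the eccentricity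
vector. The momentum is thus recovered from C, the eccentricity vector and the direction of Q. -/
lemma mom_eq (hμ : 0 < μ) (hM : 0 < M) (x : Phase) :
    ‖angMom x‖ ^ 2 • x.1 =
      (μ ^ 2 * M) • cross (angMom x) (eccVec μ M x + ‖x.2‖⁻¹ • x.2) := by
  have h : cross x.1 (angMom x) = (μ ^ 2 * M) • (eccVec μ M x + ‖x.2‖⁻¹ • x.2) := by
    rw [eccVec, sub_add_cancel, smul_smul, mul_inv_cancel₀ (by positivity), one_smul]
  have h2 := cross_cross x.1 (angMom x)
  rw [inner_mom_angMom, zero_smul, sub_zero] at h2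
  rw [← h2, h]
  apply space_ext <;> simp <;> ring

end Kepler

/-! ### The orbital frame in Euler angles -/

/-- Pericentre direction of the orbit with inclination `i`, argument of the pericentre `g` and
longitude of the node `h`. -/
def frameOne (i g h : ℝ) : Space :=
  !₂[Real.cos g * Real.cos h - Real.sin g * Real.sin h * Real.cos i,
    Real.cos g * Real.sin h + Real.sin g * Real.cos h * Real.cos i,
    Real.sin g * Real.sin i]

/-- Direction of the velocity at the pericentre. -/
def frameTwo (i g h : ℝ) : Space :=
  !₂[-Real.sin g * Real.cos h - Real.cos g * Real.sin h * Real.cos i,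
    -Real.sin g * Real.sin h + Real.cos g * Real.cos h * Real.cos i,
    Real.cos g * Real.sin i]

/-- Unit normal of the orbital plane with inclination `i` and longitude of the node `h`. -/
def frameThree (i h : ℝ) : Space :=
  !₂[Real.sin h * Real.sin i, -Real.cos h * Real.sin i, Real.cos i]

section Frame

variable (i g h : ℝ)

lemma cross_frameThree_frameOne : cross (frameThree i h) (frameOne i g h) = frameTwo i g h := by
  have hi := Real.sin_sq_add_cos_sq i
  have hh := Real.sin_sq_add_cos_sq h
  apply space_ext <;> simp [frameOne, frameTwo, frameThree]
  · linear_combination (-Real.sin g * Real.cos h) * hi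
  · linear_combination (-Real.sin g * Real.sin h) * hi
  · linear_combination (Real.cos g * Real.sin i) * hh

lemma cross_frameThree_frameTwo : cross (frameThree i h) (frameTwo i g h) = -frameOne i g h := by
  have hi := Real.sin_sq_add_cos_sq i
  have hh := Real.sin_sq_add_cos_sq h
  apply space_ext <;> simp [frameOne, frameTwo, frameThree]
  · linear_combination (-Real.cos g * Real.cos h) * hi
  · linear_combination (-Real.cos g * Real.sin h) * hi
  · linear_combination (-Real.sin g * Real.sin i) * hh

lemma inner_frameOne_self : inner ℝ (frameOne i g h) (frameOne i g h) = (1 : ℝ) := by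
  have hi := Real.sin_sq_add_cos_sq i
  have hh := Real.sin_sq_add_cos_sq h
  have hg := Real.sin_sq_add_cos_sq g
  simp only [inner_coord, frameOne]
  simp
  linear_combination (Real.cos g ^ 2 + Real.sin g ^ 2 * Real.cos i ^ 2) * hh + Real.sin g ^ 2 * hi
    + hg

lemma inner_frameTwo_self : inner ℝ (frameTwo i g h) (frameTwo i g h) = (1 : ℝ) := by
  have hi := Real.sin_sq_add_cos_sq i
  have hh := Real.sin_sq_add_cos_sq h
  have hg := Real.sin_sq_add_cos_sq g
  simp only [inner_coord, frameTwo]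
  simp
  linear_combination (Real.sin g ^ 2 + Real.cos g ^ 2 * Real.cos i ^ 2) * hh + Real.cos g ^ 2 * hi
    + hg

lemma inner_frameOne_frameTwo : inner ℝ (frameOne i g h) (frameTwo i g h) = (0 : ℝ) := by
  have hi := Real.sin_sq_add_cos_sq i
  have hh := Real.sin_sq_add_cos_sq h
  simp only [inner_coord, frameOne, frameTwo]
  simp
  linear_combination (Real.cos g * Real.sin g * (Real.cos i ^ 2 - 1)) * hh
    + Real.cos g * Real.sin g * hi

lemma frame_expansion {v : Space} (hv : inner ℝ v (frameThree i h) = (0 : ℝ)) :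
    v = (inner ℝ v (frameOne i g h) : ℝ) • frameOne i g h +
      (inner ℝ v (frameTwo i g h) : ℝ) • frameTwo i g h := by
  have hi := Real.sin_sq_add_cos_sq i
  have hh := Real.sin_sq_add_cos_sq h
  have hg := Real.sin_sq_add_cos_sq g
  simp only [inner_coord, frameThree] at hv
  simp at hv
  set si := Real.sin i
  set ci := Real.cos i
  set sh := Real.sin h
  set ch := Real.cos h
  -- N and B are the components of v in the frame with g = 0, along the node and across it; the
  -- expansion for general g is this one rotated by g.
  set N : ℝ := v 0 * ch + v 1 * sh with hN
  set B : ℝ := -v 0 * sh * ci + v 1 * ch * ci + v 2 * si with hB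
  apply space_ext <;> simp [inner_coord, frameOne, frameTwo]
  · linear_combination (-(N * ch - B * sh * ci)) * hg + sh * si * hv
      - v 0 * (hh + sh ^ 2 * hi) + v 1 * sh * ch * hi
  · linear_combination (-(N * sh + B * ch * ci)) * hg - ch * si * hv
      - v 1 * (hh + ch ^ 2 * hi) + v 0 * sh * ch * hi
  · linear_combination (-(B * si)) * hg + ci * hv - v 2 * hi

end Frame

/-! ### Reconstruction of the state from its elements -/

lemma re_eq_of_coe_eq_arg {z : ℂ} {θ : ℝ} (h : (θ : Real.Angle) = (Complex.arg z : ℝ)) :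
    z.re = ‖z‖ * Real.cos θ := by
  rw [← Real.Angle.cos_coe, h, Real.Angle.cos_coe, Complex.norm_mul_cos_arg]

lemma im_eq_of_coe_eq_arg {z : ℂ} {θ : ℝ} (h : (θ : Real.Angle) = (Complex.arg z : ℝ)) :
    z.im = ‖z‖ * Real.sin θ := by
  rw [← Real.Angle.sin_coe, h, Real.Angle.sin_coe, Complex.norm_mul_sin_arg]

/-- Coordinate along the pericentre direction of the position with eccentric anomaly `u` on the
orbit of circular angular momentum `L` and eccentricity `e`. -/
def posOne (μ M L e u : ℝ) : ℝ := L ^ 2 / (μ ^ 2 * M) * (Real.cos u - e)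
/-- Coordinate of the position across the pericentre direction. -/
def posTwo (μ M L e u : ℝ) : ℝ := L ^ 2 / (μ ^ 2 * M) * (√(1 - e ^ 2) * Real.sin u)
/-- Coordinate of the momentum along the pericentre direction. -/
def momOne (μ M L e u : ℝ) : ℝ := -(μ ^ 2 * M / L) * (Real.sin u / (1 - e * Real.cos u))
/-- Coordinate of the momentum across the pericentre direction. -/
def momTwo (μ M L e u : ℝ) : ℝ :=
  μ ^ 2 * M / L * (√(1 - e ^ 2) * Real.cos u / (1 - e * Real.cos u))

section Reconstruction

variable {μ M : ℝ} {x : Phase} {u g h : ℝ}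

/-- The complex number whose argument is the longitude of the node. -/
def nodeComplex (x : Phase) : ℂ := ⟨nodeVec x 0, nodeVec x 1⟩

/-- The complex number whose argument is the argument of the pericentre. -/
def periComplex (μ M : ℝ) (x : Phase) : ℂ :=
  ⟨inner ℝ (eccVec μ M x) (nodeVec x), inner ℝ (eccVec μ M x) (cross (normalDir x) (nodeVec x))⟩

/-- The complex number whose argument is the eccentric anomaly. -/
def anomalyComplex (μ M : ℝ) (x : Phase) : ℂ :=
  ⟨inner ℝ x.2 (periDir μ M x) / semiMajor μ M x + ecc μ M x,
    inner ℝ x.2 (cross (normalDir x) (periDir μ M x)) /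
      (semiMajor μ M x * √(1 - ecc μ M x ^ 2))⟩

lemma norm_nodeComplex (x : Phase) : ‖nodeComplex x‖ = ‖nodeVec x‖ := by
  rw [← sq_eq_sq₀ (norm_nonneg _) (norm_nonneg _), Complex.sq_norm, norm_sq_coord,
    Complex.normSq_apply]
  simp [nodeComplex]
  ring

/-- At g = 0 the first frame vector is (cos h, sin h, 0), whatever the inclination. -/
lemma nodeVec_eq (hh : (h : Real.Angle) = varh x) :
    nodeVec x = ‖nodeVec x‖ • frameOne (inclination x) 0 h := by
  have h1 : (nodeComplex x).re = _ := re_eq_of_coe_eq_arg hh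
  have h2 : (nodeComplex x).im = _ := im_eq_of_coe_eq_arg hh
  rw [norm_nodeComplex] at h1 h2
  apply space_ext
  · rw [show nodeVec x 0 = _ from h1]; simp [frameOne]
  · rw [show nodeVec x 1 = _ from h2]; simp [frameOne]
  · simp [frameOne]

/-- The node vector is the horizontal part of C turned by a right angle, so it gives the horizontal
components of C; the vertical one is ‖C‖ cos i. -/
lemma normalDir_eq (hx : x ∈ domain μ M) (hh : (h : Real.Angle) = varh x) :
    normalDir x = frameThree (inclination x) h := by
  have hC := norm_angMom_pos_of_mem hx
  have h1 := nodeVec_eq hh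
  rw [norm_nodeVec x (angMom_ne_zero_of_mem hx)] at h1
  have h1a := congr($h1 0)
  have h1b := congr($h1 1)
  simp [frameOne] at h1a h1b
  rw [normalDir, inv_smul_eq_iff₀ hC.ne']
  apply space_ext
  · rw [h1b]; simp [frameThree]; ring
  · rw [← neg_neg (angMom x 1), h1a]; simp [frameThree]; ring
  · simp [frameThree, norm_angMom_mul_cos x (angMom_ne_zero_of_mem hx)]

lemma angMom_eq (hx : x ∈ domain μ M) (hh : (h : Real.Angle) = varh x) :
    angMom x = ‖angMom x‖ • frameThree (inclination x) h := by
  rw [← normalDir_eq hx hh, normalDir, smul_smul,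
    mul_inv_cancel₀ (norm_angMom_pos_of_mem hx).ne', one_smul]

lemma inner_frameThree_of_inner_angMom (hx : x ∈ domain μ M) (hh : (h : Real.Angle) = varh x)
    {v : Space} (hv : inner ℝ v (angMom x) = (0 : ℝ)) :
    inner ℝ v (frameThree (inclination x) h) = (0 : ℝ) := by
  rw [angMom_eq hx hh, inner_smul_right] at hv
  exact (mul_eq_zero.1 hv).resolve_left (norm_angMom_pos_of_mem hx).ne'

lemma cross_smul (u v : Space) (c : ℝ) : cross u (c • v) = c • cross u v := by
  apply space_ext <;> simp <;> ring

lemma smul_cross (u v : Space) (c : ℝ) : cross (c • u) v = c • cross u v := by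
  apply space_ext <;> simp <;> ring

lemma cross_add (u v w : Space) : cross u (v + w) = cross u v + cross u w := by
  apply space_ext <;> simp <;> ring

lemma norm_frame_combination (i g h α β : ℝ) :
    ‖α • frameOne i g h + β • frameTwo i g h‖ ^ 2 = α ^ 2 + β ^ 2 := by
  have h1 := inner_frameOne_self i g h
  have h2 := inner_frameTwo_self i g h
  rw [real_inner_self_eq_norm_sq] at h1 h2
  rw [norm_add_sq_real, norm_smul, norm_smul, mul_pow, mul_pow, h1, h2, inner_smul_left,
    inner_smul_right, inner_frameOne_frameTwo]
  simp

/-- The eccentricity vector lies in the orbital plane, where the node vector and its rotation by a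
right angle are orthogonal of equal length. In particular the complex number is nonzero on the
domain. -/
lemma norm_periComplex (hx : x ∈ domain μ M) :
    ‖periComplex μ M x‖ = ecc μ M x * ‖nodeVec x‖ := by
  obtain ⟨h, hh⟩ : ∃ h : ℝ, (h : Real.Angle) = varh x := ⟨_, rfl⟩
  rw [← sq_eq_sq₀ (norm_nonneg _) (by unfold ecc; positivity), Complex.sq_norm,
    Complex.normSq_apply, periComplex, normalDir_eq hx hh, nodeVec_eq hh, cross_smul,
    cross_frameThree_frameOne]
  have he := frame_expansion _ 0 _ (inner_frameThree_of_inner_angMom hx hh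
    (inner_eccVec_angMom μ M x))
  have hn := norm_frame_combination (inclination x) 0 h
    (inner ℝ (eccVec μ M x) (frameOne (inclination x) 0 h))
    (inner ℝ (eccVec μ M x) (frameTwo (inclination x) 0 h))
  rw [← he] at hn
  have h1 := inner_frameOne_self (inclination x) 0 h
  rw [real_inner_self_eq_norm_sq] at h1
  simp only [inner_smul_right, mul_pow, norm_smul, ecc, hn, h1, norm_norm]
  ring

/-- Real and imaginary parts of `periComplex` give the components e cos g and e sin g in the frame
with g = 0; recombining them is the rotation by g. -/
lemma eccVec_eq (hx : x ∈ domain μ M) (hg : (g : Real.Angle) = varg μ M x)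
    (hh : (h : Real.Angle) = varh x) :
    eccVec μ M x = ecc μ M x • frameOne (inclination x) g h := by
  have h1 : (periComplex μ M x).re = _ := re_eq_of_coe_eq_arg hg
  have h2 : (periComplex μ M x).im = _ := im_eq_of_coe_eq_arg hg
  change _ = ‖periComplex μ M x‖ * _ at h1 h2
  rw [norm_periComplex hx, periComplex] at h1 h2
  have hn := norm_ne_zero_iff.2 (nodeVec_ne_zero_of_mem hx)
  simp only at h1 h2
  have h1' : inner ℝ (eccVec μ M x) (frameOne (inclination x) 0 h) = ecc μ M x * Real.cos g := by
    apply mul_left_cancel₀ hn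
    rw [← inner_smul_right, ← nodeVec_eq hh, h1]; ring
  have h2' : inner ℝ (eccVec μ M x) (frameTwo (inclination x) 0 h) = ecc μ M x * Real.sin g := by
    apply mul_left_cancel₀ hn
    rw [← inner_smul_right, ← cross_frameThree_frameOne, ← cross_smul, ← nodeVec_eq hh,
      ← normalDir_eq hx hh, h2]
    ring
  rw [frame_expansion _ 0 _ (inner_frameThree_of_inner_angMom hx hh
    (inner_eccVec_angMom μ M x)), h1', h2']
  apply space_ext <;> simp [frameOne, frameTwo] <;> ring

lemma periDir_eq (hx : x ∈ domain μ M) (hg : (g : Real.Angle) = varg μ M x)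
    (hh : (h : Real.Angle) = varh x) :
    periDir μ M x = frameOne (inclination x) g h := by
  rw [periDir, inv_smul_eq_iff₀ (norm_ne_zero_iff.2 (eccVec_ne_zero_of_mem hx))]
  exact eccVec_eq hx hg hh

/-- Kepler's first law: the point lies on the ellipse with a focus at the origin. -/
lemma ellipse_equation (hμ : 0 < μ) (hM : 0 < M) (hx : x ∈ domain μ M)
    (hg : (g : Real.Angle) = varg μ M x) (hh : (h : Real.Angle) = varh x) :
    ‖x.2‖ = semiMajor μ M x * (1 - ecc μ M x ^ 2)
      - ecc μ M x * inner ℝ x.2 (frameOne (inclination x) g h) := by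
  have h1 := inner_eccVec_pos μ M (pos_ne_zero_of_mem hx)
  rw [norm_angMom_sq_eq hμ hM hx, eccVec_eq hx hg hh, inner_smul_left, real_inner_comm] at h1
  simp only [conj_trivial] at h1
  have : (μ ^ 2 * M)⁻¹ * (μ ^ 2 * M * semiMajor μ M x * (1 - ecc μ M x ^ 2))
      = semiMajor μ M x * (1 - ecc μ M x ^ 2) := by
    field_simp
  linarith

/-- Squaring the focal equation r = a(1 - e²) - e q₁ and using r² = q₁² + q₂² gives the centred
equation of the ellipse, which says that the modulus is 1. Hence cos u and sin u are exactly the two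
parts. -/
lemma norm_anomalyComplex (hμ : 0 < μ) (hM : 0 < M) (hx : x ∈ domain μ M) :
    ‖anomalyComplex μ M x‖ = 1 := by
  obtain ⟨h, hh⟩ : ∃ h : ℝ, (h : Real.Angle) = varh x := ⟨_, rfl⟩
  obtain ⟨g, hg⟩ : ∃ g : ℝ, (g : Real.Angle) = varg μ M x := ⟨_, rfl⟩
  have ha := semiMajor_pos hμ hM hx
  have he := one_sub_ecc_sq_pos hμ hM hx
  have h1 := ellipse_equation hμ hM hx hg hh
  have h2 := frame_expansion _ g _ (inner_frameThree_of_inner_angMom hx hh (inner_pos_angMom x))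
  have h3 := norm_frame_combination (inclination x) g h
    (inner ℝ x.2 (frameOne (inclination x) g h)) (inner ℝ x.2 (frameTwo (inclination x) g h))
  rw [← h2, h1] at h3
  rw [← pow_eq_one_iff_of_nonneg (norm_nonneg _) two_ne_zero, Complex.sq_norm,
    Complex.normSq_apply, anomalyComplex, periDir_eq hx hg hh, normalDir_eq hx hh,
    cross_frameThree_frameOne]
  simp only
  have hs := Real.sq_sqrt he.le
  have hs0 := Real.sqrt_pos.2 he
  generalize √(1 - ecc μ M x ^ 2) = s at *
  field_simp
  rw [hs]
  linear_combination (-1 : ℝ) * h3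

lemma inner_pos_frameOne (hμ : 0 < μ) (hM : 0 < M) (hx : x ∈ domain μ M)
    (hu : (u : Real.Angle) = eccAnomaly μ M x) (hg : (g : Real.Angle) = varg μ M x)
    (hh : (h : Real.Angle) = varh x) :
    inner ℝ x.2 (frameOne (inclination x) g h) =
      semiMajor μ M x * (Real.cos u - ecc μ M x) := by
  have h1 : (anomalyComplex μ M x).re = ‖anomalyComplex μ M x‖ * _ := re_eq_of_coe_eq_arg hu
  rw [norm_anomalyComplex hμ hM hx, anomalyComplex, periDir_eq hx hg hh] at h1
  have ha := semiMajor_pos hμ hM hx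
  simp only at h1
  field_simp at h1
  linarith

lemma inner_pos_frameTwo (hμ : 0 < μ) (hM : 0 < M) (hx : x ∈ domain μ M)
    (hu : (u : Real.Angle) = eccAnomaly μ M x) (hg : (g : Real.Angle) = varg μ M x)
    (hh : (h : Real.Angle) = varh x) :
    inner ℝ x.2 (frameTwo (inclination x) g h) =
      semiMajor μ M x * (√(1 - ecc μ M x ^ 2) * Real.sin u) := by
  have h1 : (anomalyComplex μ M x).im = ‖anomalyComplex μ M x‖ * _ := im_eq_of_coe_eq_arg hu
  rw [norm_anomalyComplex hμ hM hx, anomalyComplex, periDir_eq hx hg hh, normalDir_eq hx hh,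
    cross_frameThree_frameOne] at h1
  have ha := semiMajor_pos hμ hM hx
  have hs := Real.sqrt_pos.2 (one_sub_ecc_sq_pos hμ hM hx)
  simp only at h1
  field_simp at h1
  linarith

/-- The position in terms of the elements. -/
theorem pos_eq (hμ : 0 < μ) (hM : 0 < M) (hx : x ∈ domain μ M)
    (hu : (u : Real.Angle) = eccAnomaly μ M x) (hg : (g : Real.Angle) = varg μ M x)
    (hh : (h : Real.Angle) = varh x) :
    x.2 = posOne μ M (varL μ M x) (ecc μ M x) u • frameOne (inclination x) g h +
      posTwo μ M (varL μ M x) (ecc μ M x) u • frameTwo (inclination x) g h := by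
  have ha : varL μ M x ^ 2 / (μ ^ 2 * M) = semiMajor μ M x := by
    rw [varL_sq hμ hM hx]; field_simp
  rw [posOne, posTwo, ha, ← inner_pos_frameOne hμ hM hx hu hg hh,
    ← inner_pos_frameTwo hμ hM hx hu hg hh]
  exact frame_expansion _ g _ (inner_frameThree_of_inner_angMom hx hh (inner_pos_angMom x))

lemma one_sub_mul_cos_pos {e : ℝ} (he0 : 0 < e) (he1 : e < 1) (u : ℝ) :
    0 < 1 - e * Real.cos u := by
  nlinarith [Real.cos_le_one u]

/-- The momentum in terms of the elements. -/
theorem mom_eq_frame (hμ : 0 < μ) (hM : 0 < M) (hx : x ∈ domain μ M)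
    (hu : (u : Real.Angle) = eccAnomaly μ M x) (hg : (g : Real.Angle) = varg μ M x)
    (hh : (h : Real.Angle) = varh x) :
    x.1 = momOne μ M (varL μ M x) (ecc μ M x) u • frameOne (inclination x) g h +
      momTwo μ M (varL μ M x) (ecc μ M x) u • frameTwo (inclination x) g h := by
  have h1 := mom_eq hμ hM x
  have hr := ellipse_equation hμ hM hx hg hh
  rw [inner_pos_frameOne hμ hM hx hu hg hh] at hr
  have hr' : ‖x.2‖ = semiMajor μ M x * (1 - ecc μ M x * Real.cos u) := by rw [hr]; ring
  have hG := varG_eq hμ hM hx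
  have hGp := norm_angMom_pos_of_mem hx
  have hL := varL_pos hμ hM hx
  have ha := semiMajor_pos hμ hM hx
  have hL2 := varL_sq hμ hM hx
  have hc := one_sub_mul_cos_pos (ecc_pos_of_mem hx) (ecc_lt_one hμ hM hx) u
  have he := one_sub_ecc_sq_pos hμ hM hx
  have hs := Real.sq_sqrt he.le
  have hs0 := Real.sqrt_pos.2 he
  have hx2 : x.2 = (semiMajor μ M x * (Real.cos u - ecc μ M x)) • frameOne (inclination x) g h +
      (semiMajor μ M x * (√(1 - ecc μ M x ^ 2) * Real.sin u)) • frameTwo (inclination x) g h := by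
    rw [← inner_pos_frameOne hμ hM hx hu hg hh, ← inner_pos_frameTwo hμ hM hx hu hg hh]
    exact frame_expansion _ g _ (inner_frameThree_of_inner_angMom hx hh (inner_pos_angMom x))
  rw [hr', hx2, eccVec_eq hx hg hh, angMom_eq hx hh, norm_smul, norm_norm,
    smul_cross, cross_add, cross_smul, cross_smul, cross_add, cross_smul, cross_smul,
    cross_frameThree_frameOne, cross_frameThree_frameTwo, ← hG, varG] at h1
  have hn : ‖frameThree (inclination x) h‖ = 1 := by
    rw [← normalDir_eq hx hh, normalDir, norm_smul, norm_inv, norm_norm, inv_mul_cancel₀ hGp.ne']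
  rw [hn] at h1
  rw [momOne, momTwo]
  generalize √(1 - ecc μ M x ^ 2) = s at *
  generalize hd : 1 - ecc μ M x * Real.cos u = d at *
  -- Both sides are compared after multiplication by ‖C‖² = (L √(1 - e²))², the factor occurring in
  -- `mom_eq`.
  refine smul_right_injective Space (pow_ne_zero 2 (mul_pos hL hs0).ne') ?_
  simp only
  rw [mul_one] at h1
  rw [h1]
  match_scalars
  · field_simp
    linear_combination (-ecc μ M x) * hd - Real.cos u * hs
  · field_simp

/-- Kepler's equation determines the eccentric anomaly. -/
lemma kepler_injective {e : ℝ} (he0 : 0 < e) (he1 : e < 1) :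
    Function.Injective fun u : ℝ => u - e * Real.sin u := by
  intro u v huv
  by_contra hne
  have h1 := Real.abs_sin_sub_sin_le u v
  simp only at huv
  have h2 : u - v = e * (Real.sin u - Real.sin v) := by linarith
  have h3 : |u - v| = e * |Real.sin u - Real.sin v| := by
    rw [h2, abs_mul, abs_of_pos he0]
  nlinarith [abs_pos.2 (sub_ne_zero.2 hne)]

end Reconstruction

/-! ### Injectivity of the Delaunay variables -/

theorem coords_injOn {μ M : ℝ} (hμ : 0 < μ) (hM : 0 < M) :
    Set.InjOn (coords μ M) (domain μ M) := by
  intro x hx y hy hxy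
  simp only [coords, Prod.mk.injEq] at hxy
  obtain ⟨hL, hl, hG, hg, hH, hh⟩ := hxy
  have hLp := varL_pos hμ hM hx
  have he : ecc μ M x = ecc μ M y := by
    rw [varG, varG, ← hL] at hG
    have h1 := mul_left_cancel₀ hLp.ne' hG
    rw [Real.sqrt_inj (one_sub_ecc_sq_pos hμ hM hx).le (one_sub_ecc_sq_pos hμ hM hy).le] at h1
    rw [← sq_eq_sq₀ (ecc_pos_of_mem hx).le (ecc_pos_of_mem hy).le]
    linarith
  have hi : inclination x = inclination y := by
    rw [varH, varH, ← hG] at hH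
    have h0 : varG μ M x ≠ 0 := by
      rw [varG_eq hμ hM hx]; exact (norm_angMom_pos_of_mem hx).ne'
    exact Real.injOn_cos (inclination_mem x) (inclination_mem y) (mul_left_cancel₀ h0 hH)
  obtain ⟨h, hh'⟩ : ∃ h : ℝ, (h : Real.Angle) = varh x := ⟨_, rfl⟩
  obtain ⟨g, hg'⟩ : ∃ g : ℝ, (g : Real.Angle) = varg μ M x := ⟨_, rfl⟩
  obtain ⟨u, hu⟩ : ∃ u : ℝ, (u : Real.Angle) = eccAnomaly μ M x := ⟨_, rfl⟩
  obtain ⟨v, hv⟩ : ∃ v : ℝ, (v : Real.Angle) = eccAnomaly μ M y := ⟨_, rfl⟩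
  have huv : (u : Real.Angle) = eccAnomaly μ M y := by
    rw [varl, varl, ← hu, ← hv, ← he, Real.Angle.sin_coe, Real.Angle.sin_coe,
      ← Real.Angle.coe_sub, ← Real.Angle.coe_sub, Real.Angle.angle_eq_iff_two_pi_dvd_sub] at hl
    obtain ⟨k, hk⟩ := hl
    rw [← hv, Real.Angle.angle_eq_iff_two_pi_dvd_sub]
    refine ⟨k, ?_⟩
    -- The mean anomalies differ by 2πk; shifting v by 2πk leaves its sine unchanged, so Kepler's
    -- equation over the reals applies to u and the shifted v.
    have := @kepler_injective (ecc μ M x) (ecc_pos_of_mem hx) (ecc_lt_one hμ hM hx) u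
      (v + k * (2 * Real.pi)) (by
        simp only [Real.sin_add_int_mul_two_pi]
        linarith)
    linarith
  refine Prod.ext ?_ ?_
  · rw [mom_eq_frame hμ hM hx hu hg' hh', hL, he, hi]
    exact (mom_eq_frame hμ hM hy huv (hg'.trans hg) (hh'.trans hh)).symm
  · rw [pos_eq hμ hM hx hu hg' hh', hL, he, hi]
    exact (pos_eq hμ hM hy huv (hg'.trans hg) (hh'.trans hh)).symm

/-! ### Smooth vector operations and smooth arguments -/

section Smooth

variable {E : Type*} [NormedAddCommGroup E] [NormedSpace ℝ E] {n : WithTop ℕ∞}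

lemma contDiffAt_coord {f : E → Space} {x : E} (hf : ContDiffAt ℝ n f x) (j : Fin 3) :
    ContDiffAt ℝ n (fun y => f y j) x :=
  contDiffAt_euclidean.1 hf j

lemma contDiffAt_cross {f g : E → Space} {x : E} (hf : ContDiffAt ℝ n f x)
    (hg : ContDiffAt ℝ n g x) : ContDiffAt ℝ n (fun y => cross (f y) (g y)) x := by
  have hf' := contDiffAt_coord hf
  have hg' := contDiffAt_coord hg
  rw [contDiffAt_euclidean]
  intro j
  fin_cases j
  · simpa using ((hf' 1).mul (hg' 2)).sub ((hf' 2).mul (hg' 1))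
  · simpa using ((hf' 2).mul (hg' 0)).sub ((hf' 0).mul (hg' 2))
  · simpa using ((hf' 0).mul (hg' 1)).sub ((hf' 1).mul (hg' 0))

lemma contDiffAt_complex_mk {f g : E → ℝ} {x : E} (hf : ContDiffAt ℝ n f x)
    (hg : ContDiffAt ℝ n g x) : ContDiffAt ℝ n (fun y => (⟨f y, g y⟩ : ℂ)) x :=
  Complex.equivRealProdCLM.symm.contDiff.contDiffAt.comp x (hf.prodMk hg)

lemma contDiffAt_arg {z : ℂ} (hz : z ∈ Complex.slitPlane) : ContDiffAt ℝ n Complex.arg z := by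
  have h : ContDiffAt ℝ n Complex.log z := (Complex.contDiffAt_log hz).restrict_scalars ℝ
  have h2 : Complex.arg = fun w => Complex.imCLM (Complex.log w) := by
    funext w; simp [Complex.log_im]
  rw [h2]
  exact Complex.imCLM.contDiff.contDiffAt.comp z h

/-- The argument of a nonvanishing smooth complex function has smooth local determinations. -/
lemma exists_smooth_arg {D : Set E} (hD : IsOpen D) {z : E → ℂ}
    (hz : ∀ y ∈ D, ContDiffAt ℝ ∞ z y) (h0 : ∀ y ∈ D, z y ≠ 0) {x : E} (hx : x ∈ D) :
    ∃ (U : Set E) (θ : E → ℝ), IsOpen U ∧ x ∈ U ∧ U ⊆ D ∧ (∀ y ∈ U, ContDiffAt ℝ ∞ θ y) ∧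
      ∀ y ∈ U, (θ y : Real.Angle) = (Complex.arg (z y) : ℝ) := by
  -- Dividing by the value at x brings that value to 1, away from the branch cut; the argument of z
  -- x is added back.
  have hw : ∀ y ∈ D, ContDiffAt ℝ ∞ (fun y => z y * (z x)⁻¹) y := fun y hy =>
    (hz y hy).mul contDiffAt_const
  refine ⟨D ∩ (fun y => z y * (z x)⁻¹) ⁻¹' Complex.slitPlane,
    fun y => Complex.arg (z y * (z x)⁻¹) + Complex.arg (z x), ?_, ?_, Set.inter_subset_left,
    ?_, ?_⟩
  · exact ContinuousOn.isOpen_inter_preimage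
      (fun y hy => (hw y hy).continuousAt.continuousWithinAt) hD Complex.isOpen_slitPlane
  · refine ⟨hx, ?_⟩
    simp [h0 x hx]
  · rintro y ⟨hy, hys⟩
    exact ((contDiffAt_arg hys).comp y (hw y hy)).add contDiffAt_const
  · rintro y ⟨hy, hys⟩
    rw [Real.Angle.coe_add, ← Complex.arg_mul_coe_angle (Complex.slitPlane_ne_zero hys) (h0 x hx),
      inv_mul_cancel_right₀ (h0 x hx)]

end Smooth

/-! ### Smoothness of the elements and openness of the domain -/

section Elements

variable {μ M : ℝ} {x : Phase} {n : WithTop ℕ∞}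

lemma contDiffAt_angMom : ContDiffAt ℝ n angMom x :=
  contDiffAt_cross contDiffAt_snd contDiffAt_fst

lemma contDiffAt_nodeVec : ContDiffAt ℝ n nodeVec x :=
  contDiffAt_cross contDiffAt_const contDiffAt_angMom

lemma contDiffAt_energy (hx : x.2 ≠ 0) : ContDiffAt ℝ n (energy μ M) x :=
  ((contDiffAt_fst.norm_sq ℝ).div_const _).sub
    (contDiffAt_const.div (contDiffAt_snd.norm ℝ hx) (norm_ne_zero_iff.2 hx))

lemma contDiffAt_eccVec (hx : x.2 ≠ 0) : ContDiffAt ℝ n (eccVec μ M) x := by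
  have h1 : ContDiffAt ℝ n (fun y : Phase => cross y.1 (angMom y)) x :=
    contDiffAt_cross contDiffAt_fst contDiffAt_angMom
  have h2 : ContDiffAt ℝ n (fun y : Phase => ‖y.2‖⁻¹) x :=
    (contDiffAt_snd.norm ℝ hx).inv (norm_ne_zero_iff.2 hx)
  exact (h1.const_smul ((μ ^ 2 * M)⁻¹)).sub (h2.smul contDiffAt_snd)

lemma isOpen_domain (μ M : ℝ) : IsOpen (domain μ M) := by
  rw [isOpen_iff_mem_nhds]
  intro x hx
  obtain ⟨h1, h2, h3, h4⟩ := mem_domain_iff.1 hx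
  filter_upwards [continuousAt_snd.eventually_ne h1,
    (contDiffAt_energy (n := 0) h1).continuousAt.eventually_lt continuousAt_const h2,
    (contDiffAt_nodeVec (n := 0)).continuousAt.eventually_ne h3,
    (contDiffAt_eccVec (n := 0) h1).continuousAt.eventually_ne h4] with y g1 g2 g3 g4
  exact mem_domain_iff.2 ⟨g1, g2, g3, g4⟩

lemma contDiffAt_semiMajor (hx : x ∈ domain μ M) : ContDiffAt ℝ n (semiMajor μ M) x :=
  contDiffAt_const.div (contDiffAt_const.mul (contDiffAt_energy (pos_ne_zero_of_mem hx)))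
    (mul_ne_zero two_ne_zero (energy_neg_of_mem hx).ne)

lemma contDiffAt_ecc (hx : x ∈ domain μ M) : ContDiffAt ℝ n (ecc μ M) x :=
  (contDiffAt_eccVec (pos_ne_zero_of_mem hx)).norm ℝ (eccVec_ne_zero_of_mem hx)

lemma contDiffAt_sqrt_one_sub_ecc_sq (hμ : 0 < μ) (hM : 0 < M) (hx : x ∈ domain μ M) :
    ContDiffAt ℝ n (fun y => √(1 - ecc μ M y ^ 2)) x :=
  (contDiffAt_const.sub ((contDiffAt_ecc hx).pow 2)).sqrt (one_sub_ecc_sq_pos hμ hM hx).ne'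

lemma contDiffAt_varL (hμ : 0 < μ) (hM : 0 < M) (hx : x ∈ domain μ M) :
    ContDiffAt ℝ n (varL μ M) x :=
  contDiffAt_const.mul ((contDiffAt_semiMajor hx).sqrt (semiMajor_pos hμ hM hx).ne')

lemma contDiffAt_varG (hμ : 0 < μ) (hM : 0 < M) (hx : x ∈ domain μ M) :
    ContDiffAt ℝ n (varG μ M) x :=
  (contDiffAt_varL hμ hM hx).mul (contDiffAt_sqrt_one_sub_ecc_sq hμ hM hx)

lemma sin_inclination_pos (hx : x ∈ domain μ M) : 0 < Real.sin (inclination x) := by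
  have h := norm_pos_iff.2 (nodeVec_ne_zero_of_mem hx)
  rw [norm_nodeVec x (angMom_ne_zero_of_mem hx)] at h
  exact (pos_iff_pos_of_mul_pos h).1 (norm_angMom_pos_of_mem hx)

lemma contDiffAt_inclination (hx : x ∈ domain μ M) : ContDiffAt ℝ n inclination x := by
  have hC := angMom_ne_zero_of_mem hx
  have hs := sin_inclination_pos hx
  have hsc := Real.sin_sq_add_cos_sq (inclination x)
  have hi : inclination = fun y => Real.arccos (angMom y 2 / ‖angMom y‖) := by
    funext y
    rw [← cos_inclination, Real.arccos_cos (inclination_mem y).1 (inclination_mem y).2]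
  have h1 : ContDiffAt ℝ n (fun y => angMom y 2 / ‖angMom y‖) x :=
    (contDiffAt_coord contDiffAt_angMom 2).div (contDiffAt_angMom.norm ℝ hC)
      (norm_ne_zero_iff.2 hC)
  rw [hi]
  -- The arccosine is smooth away from ±1, and cos i = ±1 is excluded by sin i > 0.
  refine ContDiffAt.comp x (g := Real.arccos) (Real.contDiffAt_arccos ?_ ?_) h1
  · rw [← cos_inclination]; intro h; rw [h] at hsc; nlinarith
  · rw [← cos_inclination]; intro h; rw [h] at hsc; nlinarith

lemma contDiffAt_varH (hμ : 0 < μ) (hM : 0 < M) (hx : x ∈ domain μ M) :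
    ContDiffAt ℝ n (varH μ M) x :=
  (contDiffAt_varG hμ hM hx).mul (contDiffAt_inclination hx).cos

lemma contDiffAt_normalDir (hx : x ∈ domain μ M) : ContDiffAt ℝ n normalDir x :=
  ((contDiffAt_angMom.norm ℝ (angMom_ne_zero_of_mem hx)).inv
    (norm_angMom_pos_of_mem hx).ne').smul contDiffAt_angMom

lemma contDiffAt_periDir (hx : x ∈ domain μ M) : ContDiffAt ℝ n (periDir μ M) x :=
  ((contDiffAt_ecc hx).inv (ecc_pos_of_mem hx).ne').smul
    (contDiffAt_eccVec (pos_ne_zero_of_mem hx))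

lemma contDiffAt_nodeComplex : ContDiffAt ℝ n nodeComplex x :=
  contDiffAt_complex_mk (contDiffAt_coord contDiffAt_nodeVec 0)
    (contDiffAt_coord contDiffAt_nodeVec 1)

lemma contDiffAt_periComplex (hx : x ∈ domain μ M) : ContDiffAt ℝ n (periComplex μ M) x :=
  have he : ContDiffAt ℝ n (eccVec μ M) x := contDiffAt_eccVec (pos_ne_zero_of_mem hx)
  contDiffAt_complex_mk (he.inner ℝ contDiffAt_nodeVec)
    (he.inner ℝ (contDiffAt_cross (contDiffAt_normalDir hx) contDiffAt_nodeVec))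

lemma contDiffAt_anomalyComplex (hμ : 0 < μ) (hM : 0 < M) (hx : x ∈ domain μ M) :
    ContDiffAt ℝ n (anomalyComplex μ M) x :=
  have ha := (semiMajor_pos hμ hM hx).ne'
  have hs := (Real.sqrt_pos.2 (one_sub_ecc_sq_pos hμ hM hx)).ne'
  contDiffAt_complex_mk
    (((contDiffAt_snd.inner ℝ (contDiffAt_periDir hx)).div (contDiffAt_semiMajor hx) ha).add
      (contDiffAt_ecc hx))
    ((contDiffAt_snd.inner ℝ
      (contDiffAt_cross (contDiffAt_normalDir hx) (contDiffAt_periDir hx))).div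
      ((contDiffAt_semiMajor hx).mul (contDiffAt_sqrt_one_sub_ecc_sq hμ hM hx))
      (mul_ne_zero ha hs))

/-- Near each point of the domain the eccentric anomaly, the argument of the pericentre and the
longitude of the node have smooth real determinations. -/
theorem exists_smooth_lifts (hμ : 0 < μ) (hM : 0 < M) (hx : x ∈ domain μ M) :
    ∃ (U : Set Phase) (u g h : Phase → ℝ), IsOpen U ∧ x ∈ U ∧ U ⊆ domain μ M ∧
      (∀ y ∈ U, ContDiffAt ℝ ∞ u y ∧ ContDiffAt ℝ ∞ g y ∧ ContDiffAt ℝ ∞ h y) ∧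
      ∀ y ∈ U, (u y : Real.Angle) = eccAnomaly μ M y ∧ (g y : Real.Angle) = varg μ M y ∧
        (h y : Real.Angle) = varh y := by
  obtain ⟨U₁, u, hU₁, hx₁, hs₁, hu, hu'⟩ := exists_smooth_arg (isOpen_domain μ M)
    (fun y hy => contDiffAt_anomalyComplex hμ hM hy)
    (fun y hy => norm_ne_zero_iff.1 (by rw [norm_anomalyComplex hμ hM hy]; exact one_ne_zero)) hx
  obtain ⟨U₂, g, hU₂, hx₂, -, hg, hg'⟩ := exists_smooth_arg (isOpen_domain μ M)
    (fun y hy => contDiffAt_periComplex hy)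
    (fun y hy => norm_ne_zero_iff.1 (by
      rw [norm_periComplex hy]
      exact mul_ne_zero (ecc_pos_of_mem hy).ne' (norm_ne_zero_iff.2 (nodeVec_ne_zero_of_mem hy))))
    hx
  obtain ⟨U₃, h, hU₃, hx₃, -, hh, hh'⟩ := exists_smooth_arg (isOpen_domain μ M)
    (z := nodeComplex) (fun y _ => contDiffAt_nodeComplex)
    (fun y hy => norm_ne_zero_iff.1 (by
      rw [norm_nodeComplex]; exact norm_ne_zero_iff.2 (nodeVec_ne_zero_of_mem hy))) hx
  exact ⟨U₁ ∩ (U₂ ∩ U₃), u, g, h, hU₁.inter (hU₂.inter hU₃), ⟨hx₁, hx₂, hx₃⟩,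
    fun y hy => hs₁ hy.1, fun y hy => ⟨hu y hy.1, hg y hy.2.1, hh y hy.2.2⟩,
    fun y hy => ⟨hu' y hy.1, hg' y hy.2.1, hh' y hy.2.2⟩⟩

end Elements

/-! ### Density of the domain -/

section Density

variable {μ M : ℝ}

lemma isOpen_elliptic (μ M : ℝ) : IsOpen (elliptic μ M) := by
  rw [isOpen_iff_mem_nhds]
  intro x hx
  filter_upwards [continuousAt_snd.eventually_ne hx.1,
    (contDiffAt_energy (n := 0) hx.1).continuousAt.eventually_lt continuousAt_const hx.2]
    with y g1 g2
  exact ⟨g1, g2⟩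

/-- A point is in the closure of a set entered along a curve for arbitrarily small parameters. -/
lemma mem_closure_of_curve {X : Type*} [TopologicalSpace X] {c : ℝ → X} (hc : Continuous c)
    {S A : Set X} (hA : IsOpen A) (h0 : c 0 ∈ A) {ε : ℝ} (hε : 0 < ε)
    (h : ∀ t, 0 < t → t < ε → c t ∈ A → c t ∈ S) : c 0 ∈ closure S := by
  have h1 : ∀ᶠ t in nhdsWithin (0 : ℝ) (Set.Ioi 0), c t ∈ S := by
    filter_upwards [mem_nhdsWithin_of_mem_nhds (hc.continuousAt.preimage_mem_nhds
      (hA.mem_nhds h0)), Ioo_mem_nhdsGT hε] with t ht1 ht2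
    exact h t ht2.1 ht2.2 ht1
  exact mem_closure_of_tendsto (hc.continuousAt.tendsto.mono_left nhdsWithin_le_nhds) h1

lemma exists_nodeVec_ne_zero {q : Space} (hq : q ≠ 0) :
    ∃ w : Space, cross vertical (cross q w) ≠ 0 := by
  by_contra! hc
  apply hq
  have h1 := hc !₂[1, 0, 0]
  have h2 := hc !₂[0, 1, 0]
  have h3 := hc !₂[0, 0, 1]
  rw [space_eq_zero_iff] at h1 h2 h3
  simp at h1 h2 h3
  exact space_ext (by simp [h3]) (by simp [h3]) (by simp [h1])

/-- At fixed position the node vector is linear in the momentum, so where it vanishes it becomes t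
times a nonzero vector along P + t w. Rectilinear and horizontal states are treated together. -/
lemma elliptic_subset_closure_nodeVec :
    elliptic μ M ⊆ closure {x | x ∈ elliptic μ M ∧ nodeVec x ≠ 0} := by
  intro x hx
  by_cases hn : nodeVec x = 0
  swap
  · exact subset_closure ⟨hx, hn⟩
  obtain ⟨w, hw⟩ := exists_nodeVec_ne_zero hx.1
  have := mem_closure_of_curve (c := fun t : ℝ => ((x.1 + t • w, x.2) : Phase)) (by fun_prop)
    (S := {x | x ∈ elliptic μ M ∧ nodeVec x ≠ 0}) (isOpen_elliptic μ M) (by simpa using hx)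
    one_pos ?_
  · simpa using this
  · intro t ht _ hA
    refine ⟨hA, ?_⟩
    have : nodeVec (x.1 + t • w, x.2) = nodeVec x + t • cross vertical (cross x.2 w) := by
      simp only [nodeVec, angMom, cross_add, cross_smul]
    rw [this, hn, zero_add]
    exact smul_ne_zero ht.ne' hw

lemma elliptic_subset_closure_domain :
    elliptic μ M ⊆ closure (domain μ M) := by
  refine elliptic_subset_closure_nodeVec.trans (closure_minimal ?_ isClosed_closure)
  rintro x ⟨hx, hn⟩
  by_cases he : eccVec μ M x = 0
  swap
  · exact subset_closure (mem_domain_iff.2 ⟨hx.1, hx.2, hn, he⟩)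
  -- Circular states are left by rescaling the momentum, which keeps the orbital plane.
  have := mem_closure_of_curve (c := fun t : ℝ => (((1 + t) • x.1, x.2) : Phase)) (by fun_prop)
    (S := domain μ M) (isOpen_elliptic μ M) (by simpa using hx) one_pos ?_
  · simpa using this
  · intro t ht _ hA
    refine mem_domain_iff.2 ⟨hA.1, hA.2, ?_, ?_⟩
    · have : nodeVec ((1 + t) • x.1, x.2) = (1 + t) • nodeVec x := by
        simp only [nodeVec, angMom, cross_smul]
      rw [this]
      exact smul_ne_zero (by positivity) hn
    -- P × (Q × P) is quadratic in P while Q / ‖Q‖ does not involve it; from e = 0 the rescaling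
    -- leaves a nonzero multiple of Q.
    · have h1 : eccVec μ M ((1 + t) • x.1, x.2) =
          (1 + t) ^ 2 • eccVec μ M x + (((1 + t) ^ 2 - 1) * ‖x.2‖⁻¹) • x.2 := by
        simp only [eccVec, angMom, cross_smul, smul_cross]
        module
      rw [h1, he, smul_zero, zero_add]
      refine smul_ne_zero (mul_ne_zero (by nlinarith) ?_) hx.1
      exact inv_ne_zero (norm_ne_zero_iff.2 hx.1)

end Density

/-! ### Derivatives in the moving frame and the planar form -/

section Calculus

/-- Derivative of `posOne` along a curve of elements. -/
def dPosOne (μ M L e u L' e' u' : ℝ) : ℝ :=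
  2 * L * L' / (μ ^ 2 * M) * (Real.cos u - e) + L ^ 2 / (μ ^ 2 * M) * (-Real.sin u * u' - e')
/-- Derivative of `posTwo` along a curve of elements. -/
def dPosTwo (μ M L e u L' e' u' : ℝ) : ℝ :=
  2 * L * L' / (μ ^ 2 * M) * (√(1 - e ^ 2) * Real.sin u) + L ^ 2 / (μ ^ 2 * M) *
    (-(e * e') / √(1 - e ^ 2) * Real.sin u + √(1 - e ^ 2) * (Real.cos u * u'))
/-- Derivative of `momOne` along a curve of elements. -/
def dMomOne (μ M L e u L' e' u' : ℝ) : ℝ :=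
  μ ^ 2 * M * L' / L ^ 2 * (Real.sin u / (1 - e * Real.cos u)) - μ ^ 2 * M / L *
    ((Real.cos u * u' * (1 - e * Real.cos u)
      - Real.sin u * (-(e' * Real.cos u) + e * (Real.sin u * u'))) / (1 - e * Real.cos u) ^ 2)
/-- Derivative of `momTwo` along a curve of elements. -/
def dMomTwo (μ M L e u L' e' u' : ℝ) : ℝ :=
  -(μ ^ 2 * M * L') / L ^ 2 * (√(1 - e ^ 2) * Real.cos u / (1 - e * Real.cos u)) +
    μ ^ 2 * M / L *
    (((-(e * e') / √(1 - e ^ 2) * Real.cos u + √(1 - e ^ 2) * (-Real.sin u * u')) *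
        (1 - e * Real.cos u)
      - √(1 - e ^ 2) * Real.cos u * (-(e' * Real.cos u) + e * (Real.sin u * u'))) /
      (1 - e * Real.cos u) ^ 2)

variable {μ M : ℝ} {L e u i g h : ℝ → ℝ} {L' e' u' i' g' h' t : ℝ}

lemma hasDerivAt_sqrt_one_sub_sq (he : HasDerivAt e e' t) (h1 : 0 < 1 - e t ^ 2) :
    HasDerivAt (fun t => √(1 - e t ^ 2)) (-(e t * e') / √(1 - e t ^ 2)) t := by
  refine (((he.pow 2).const_sub 1).sqrt h1.ne').congr_deriv ?_
  simp
  field_simp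

lemma hasDerivAt_posOne (hL : HasDerivAt L L' t) (he : HasDerivAt e e' t)
    (hu : HasDerivAt u u' t) :
    HasDerivAt (fun t => posOne μ M (L t) (e t) (u t))
      (dPosOne μ M (L t) (e t) (u t) L' e' u') t := by
  refine HasDerivAt.congr_deriv (((hL.pow 2).div_const (μ ^ 2 * M)).mul (hu.cos.sub he)) ?_
  simp [dPosOne]

lemma hasDerivAt_posTwo (hL : HasDerivAt L L' t) (he : HasDerivAt e e' t)
    (hu : HasDerivAt u u' t) (h1 : 0 < 1 - e t ^ 2) :
    HasDerivAt (fun t => posTwo μ M (L t) (e t) (u t))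
      (dPosTwo μ M (L t) (e t) (u t) L' e' u') t := by
  refine HasDerivAt.congr_deriv (((hL.pow 2).div_const (μ ^ 2 * M)).mul ((hasDerivAt_sqrt_one_sub_sq he h1).mul hu.sin)) ?_
  simp [dPosTwo]

lemma hasDerivAt_momOne (hL : HasDerivAt L L' t) (he : HasDerivAt e e' t)
    (hu : HasDerivAt u u' t) (hL0 : L t ≠ 0) (hd : 1 - e t * Real.cos (u t) ≠ 0) :
    HasDerivAt (fun t => momOne μ M (L t) (e t) (u t))
      (dMomOne μ M (L t) (e t) (u t) L' e' u') t := by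
  refine HasDerivAt.congr_deriv ((((hasDerivAt_const t (μ ^ 2 * M)).div hL hL0).neg).mul
    (hu.sin.div ((he.mul hu.cos).const_sub 1) hd)) ?_
  simp [dMomOne]
  ring

lemma hasDerivAt_momTwo (hL : HasDerivAt L L' t) (he : HasDerivAt e e' t)
    (hu : HasDerivAt u u' t) (hL0 : L t ≠ 0) (hd : 1 - e t * Real.cos (u t) ≠ 0)
    (h1 : 0 < 1 - e t ^ 2) :
    HasDerivAt (fun t => momTwo μ M (L t) (e t) (u t))
      (dMomTwo μ M (L t) (e t) (u t) L' e' u') t := by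
  refine HasDerivAt.congr_deriv ((((hasDerivAt_const t (μ ^ 2 * M)).div hL hL0)).mul
    (((hasDerivAt_sqrt_one_sub_sq he h1).mul hu.cos).div ((he.mul hu.cos).const_sub 1) hd)) ?_
  simp only [dMomTwo, Pi.mul_apply, Pi.div_apply]
  ring

lemma hasDerivAt_of_coord {f : ℝ → Space} {f' : Space}
    (hf : ∀ j, HasDerivAt (fun t => f t j) (f' j) t) : HasDerivAt f f' t := by
  rw [hasDerivAt_iff_hasFDerivAt, ← hasFDerivWithinAt_univ, hasFDerivWithinAt_euclidean]
  intro j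
  rw [hasFDerivWithinAt_univ]
  exact (hf j).hasFDerivAt.congr_fderiv (by ext; simp)

/-- The angular velocity of the frame is i' about the node, h' about the vertical and g' about the
normal; its normal component is g' + h' cos i. -/
lemma hasDerivAt_frameOne (hi : HasDerivAt i i' t) (hg : HasDerivAt g g' t)
    (hh : HasDerivAt h h' t) :
    HasDerivAt (fun t => frameOne (i t) (g t) (h t))
      ((g' + Real.cos (i t) * h') • frameTwo (i t) (g t) (h t) +
        (i' * Real.sin (g t) - h' * Real.sin (i t) * Real.cos (g t)) • frameThree (i t) (h t))
      t := by
  have hs := Real.sin_sq_add_cos_sq (i t)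
  apply hasDerivAt_of_coord
  intro j
  fin_cases j
  · refine HasDerivAt.congr_deriv ((hg.cos.mul hh.cos).sub ((hg.sin.mul hh.sin).mul hi.cos)) ?_
    simp [frameTwo, frameThree]
    linear_combination (h' * Real.cos (g t) * Real.sin (h t)) * hs
  · refine HasDerivAt.congr_deriv ((hg.cos.mul hh.sin).add ((hg.sin.mul hh.cos).mul hi.cos)) ?_
    simp [frameTwo, frameThree]
    linear_combination (-h' * Real.cos (g t) * Real.cos (h t)) * hs
  · refine HasDerivAt.congr_deriv (hg.sin.mul hi.sin) ?_
    simp [frameTwo, frameThree]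
    ring

lemma hasDerivAt_frameTwo (hi : HasDerivAt i i' t) (hg : HasDerivAt g g' t)
    (hh : HasDerivAt h h' t) :
    HasDerivAt (fun t => frameTwo (i t) (g t) (h t))
      (-(g' + Real.cos (i t) * h') • frameOne (i t) (g t) (h t) +
        (i' * Real.cos (g t) + h' * Real.sin (i t) * Real.sin (g t)) • frameThree (i t) (h t))
      t := by
  have hs := Real.sin_sq_add_cos_sq (i t)
  apply hasDerivAt_of_coord
  intro j
  fin_cases j
  · refine HasDerivAt.congr_deriv ((hg.sin.neg.mul hh.cos).sub ((hg.cos.mul hh.sin).mul hi.cos)) ?_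
    simp [frameOne, frameThree]
    linear_combination (-h' * Real.sin (g t) * Real.sin (h t)) * hs
  · refine HasDerivAt.congr_deriv ((hg.sin.neg.mul hh.sin).add ((hg.cos.mul hh.cos).mul hi.cos)) ?_
    simp [frameOne, frameThree]
    linear_combination (h' * Real.sin (g t) * Real.cos (h t)) * hs
  · refine HasDerivAt.congr_deriv (hg.cos.mul hi.sin) ?_
    simp [frameOne, frameThree]
    ring

/-- Velocity of a vector of the moving orbital plane, in the moving frame. -/
lemma hasDerivAt_frame_combination {a b : ℝ → ℝ} {a' b' : ℝ} (ha : HasDerivAt a a' t)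
    (hb : HasDerivAt b b' t) (hi : HasDerivAt i i' t) (hg : HasDerivAt g g' t)
    (hh : HasDerivAt h h' t) :
    HasDerivAt (fun t => a t • frameOne (i t) (g t) (h t) + b t • frameTwo (i t) (g t) (h t))
      ((a' - b t * (g' + Real.cos (i t) * h')) • frameOne (i t) (g t) (h t) +
        (b' + a t * (g' + Real.cos (i t) * h')) • frameTwo (i t) (g t) (h t) +
        (i' * (a t * Real.sin (g t) + b t * Real.cos (g t)) +
          h' * Real.sin (i t) * (b t * Real.sin (g t) - a t * Real.cos (g t))) •
            frameThree (i t) (h t)) t := by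
  refine HasDerivAt.congr_deriv ((ha.smul (hasDerivAt_frameOne hi hg hh)).add
    (hb.smul (hasDerivAt_frameTwo hi hg hh))) ?_
  module

/-- The planar part of the symplectic form. -/
lemma planar_form (hμ : 0 < μ) (hM : 0 < M) {L e u : ℝ} (hL : 0 < L) (he0 : 0 < e) (he : e < 1)
    (L₁ e₁ u₁ L₂ e₂ u₂ : ℝ) :
    dMomOne μ M L e u L₁ e₁ u₁ * dPosOne μ M L e u L₂ e₂ u₂
      - dMomOne μ M L e u L₂ e₂ u₂ * dPosOne μ M L e u L₁ e₁ u₁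
      + dMomTwo μ M L e u L₁ e₁ u₁ * dPosTwo μ M L e u L₂ e₂ u₂
      - dMomTwo μ M L e u L₂ e₂ u₂ * dPosTwo μ M L e u L₁ e₁ u₁ =
    L₁ * (u₂ - (e₂ * Real.sin u + e * (Real.cos u * u₂)))
      - L₂ * (u₁ - (e₁ * Real.sin u + e * (Real.cos u * u₁))) := by
  have hd := one_sub_mul_cos_pos he0 he u
  have h1 : 0 < 1 - e ^ 2 := by nlinarith
  have hs := Real.sq_sqrt h1.le
  have hs0 := Real.sqrt_pos.2 h1
  have hsc := Real.sin_sq_add_cos_sq u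
  have hk : 0 < μ ^ 2 * M := by positivity
  simp only [dMomOne, dMomTwo, dPosOne, dPosTwo]
  generalize √(1 - e ^ 2) = s at *
  generalize Real.sin u = y at *
  generalize Real.cos u = c at *
  generalize μ ^ 2 * M = k at *
  have hy : y ^ 2 = 1 - c ^ 2 := by linarith
  obtain ⟨d, hdef⟩ : ∃ d, d = 1 - e * c := ⟨_, rfl⟩
  rw [← hdef] at hd ⊢
  -- The derivatives are split into their coefficients on u' and e'.
  have hP₁ : ∀ e' u' : ℝ, (c * u' * d - y * (-(e' * c) + e * (y * u'))) / d ^ 2 =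
      (c - e) / d ^ 2 * u' + y * c / d ^ 2 * e' := by
    intro e' u'
    field_simp
    rw [hdef]
    linear_combination (-e * u') * hy
  have hP₂ : ∀ e' u' : ℝ, ((-(e * e') / s * c + s * (-y * u')) * d
      - s * c * (-(e' * c) + e * (y * u'))) / d ^ 2 =
      -(s * y) / d ^ 2 * u' + c * (c - e) / (s * d ^ 2) * e' := by
    intro e' u'
    field_simp
    rw [hs, hdef]
    ring
  have hQ₂ : ∀ e' u' : ℝ, -(e * e') / s * y + s * (c * u') = s * c * u' + -(e * y / s) * e' := by
    intro e' u'; ring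
  simp only [hP₁, hP₂, hQ₂]
  -- These are the coefficients of de ∧ du, dL ∧ du and dL ∧ de: 0, 1 - e cos u and -sin u, in
  -- accordance with dl = (1 - e cos u) du - sin u de.
  have I₁ : y * c / d ^ 2 * y + (c * (c - e) / (s * d ^ 2)) * (s * c)
      - (c - e) / d ^ 2 - (-(s * y) / d ^ 2) * (-(e * y / s)) = 0 := by
    field_simp
    linear_combination (c - e) * hy
  have I₂ : -(y / d * y + s * c / d * (s * c))
      - 2 * (-((c - e) / d ^ 2 * (c - e)) + s * y * (-(s * y) / d ^ 2)) = d := by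
    field_simp
    rw [hs, hy, hdef]
    ring
  have I₃ : -(y / d + s * c / d * (-(e * y / s)))
      - 2 * (-(y * c / d ^ 2 * (c - e)) + s * y * (c * (c - e) / (s * d ^ 2))) = -y := by
    field_simp
    rw [hdef]
    ring
  generalize y / d = A at *
  generalize s * c / d = B at *
  generalize (c - e) / d ^ 2 = A₁ at *
  generalize y * c / d ^ 2 = A₂ at *
  generalize -(s * y) / d ^ 2 = B₁ at *
  generalize c * (c - e) / (s * d ^ 2) = B₂ at *
  generalize e * y / s = F at *
  field_simp
  linear_combination (L ^ 2 * (e₁ * u₂ - e₂ * u₁)) * I₁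
    + (L * (L₁ * u₂ - L₂ * u₁)) * (I₂ + hdef) + (L * (L₁ * e₂ - L₂ * e₁)) * I₃

/-- Expresses G as q₁p₂ - q₂p₁, the combination produced by the rotation of the frame in the
symplectic form. -/
lemma angular_momentum_planar (hμ : 0 < μ) (hM : 0 < M) {L e u : ℝ} (hL : 0 < L) (he0 : 0 < e)
    (he : e < 1) :
    posOne μ M L e u * momTwo μ M L e u - posTwo μ M L e u * momOne μ M L e u
      = L * √(1 - e ^ 2) := by
  have hd := one_sub_mul_cos_pos he0 he u
  have hsc := Real.sin_sq_add_cos_sq u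
  simp only [posOne, posTwo, momOne, momTwo]
  generalize √(1 - e ^ 2) = s at *
  generalize hd' : 1 - e * Real.cos u = d at *
  field_simp
  linear_combination s * hsc + s * hd'

end Calculus

/-! ### The symplectic form in the moving frame -/

lemma inner_frameOne_frameThree (i g h : ℝ) :
    inner ℝ (frameOne i g h) (frameThree i h) = (0 : ℝ) := by
  simp only [inner_coord, frameOne, frameThree]
  simp
  linear_combination (-Real.sin g * Real.cos i * Real.sin i) * Real.sin_sq_add_cos_sq h

lemma inner_frameTwo_frameThree (i g h : ℝ) :
    inner ℝ (frameTwo i g h) (frameThree i h) = (0 : ℝ) := by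
  simp only [inner_coord, frameTwo, frameThree]
  simp
  linear_combination (-Real.cos g * Real.cos i * Real.sin i) * Real.sin_sq_add_cos_sq h

lemma inner_frameThree_self (i h : ℝ) :
    inner ℝ (frameThree i h) (frameThree i h) = (1 : ℝ) := by
  simp only [inner_coord, frameThree]
  simp
  linear_combination (Real.sin i ^ 2) * Real.sin_sq_add_cos_sq h + Real.sin_sq_add_cos_sq i

lemma inner_frame (i g h a b c a' b' c' : ℝ) :
    inner ℝ (a • frameOne i g h + b • frameTwo i g h + c • frameThree i h)
      (a' • frameOne i g h + b' • frameTwo i g h + c' • frameThree i h) =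
      a * a' + b * b' + c * c' := by
  simp only [inner_add_left, inner_add_right, inner_smul_left, inner_smul_right,
    inner_frameOne_self, inner_frameTwo_self, inner_frameThree_self, inner_frameOne_frameTwo,
    inner_frameOne_frameThree, inner_frameTwo_frameThree,
    real_inner_comm (frameOne i g h) (frameTwo i g h),
    real_inner_comm (frameOne i g h) (frameThree i h),
    real_inner_comm (frameTwo i g h) (frameThree i h)]
  simp
  ring

lemma omega_eq_inner (v w : Phase) : omega v w = inner ℝ v.1 w.2 - inner ℝ w.1 v.2 := by
  simp only [omega, Fin.sum_univ_three, inner_coord]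
  ring

lemma hasDerivAt_along_line {E : Type*} [NormedAddCommGroup E] [NormedSpace ℝ E] {f : E → ℝ}
    {y : E} (hf : DifferentiableAt ℝ f y) (v : E) :
    HasDerivAt (fun t : ℝ => f (y + t • v)) (fderiv ℝ f y v) 0 := by
  exact hf.hasFDerivAt.hasLineDerivAt v

section Form

variable {μ M : ℝ} {U : Set Phase} {u g h : Phase → ℝ}

/-- Tangent vectors in the moving frame, in terms of the differentials of the elements. -/
lemma tangent_eq (hμ : 0 < μ) (hM : 0 < M) (hU : IsOpen U) (hUD : U ⊆ domain μ M)
    (hlift : ∀ y ∈ U, (u y : Real.Angle) = eccAnomaly μ M y ∧ (g y : Real.Angle) = varg μ M y ∧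
      (h y : Real.Angle) = varh y) {y : Phase} (hy : y ∈ U) (hu : DifferentiableAt ℝ u y)
    (hg : DifferentiableAt ℝ g y) (hh : DifferentiableAt ℝ h y) (v : Phase) :
    ∀ {L e i L' e' u' i' φ' h' : ℝ}, L = varL μ M y → e = ecc μ M y → i = inclination y →
      L' = fderiv ℝ (varL μ M) y v → e' = fderiv ℝ (ecc μ M) y v → u' = fderiv ℝ u y v →
      i' = fderiv ℝ inclination y v → h' = fderiv ℝ h y v →
      φ' = fderiv ℝ g y v + Real.cos i * h' →
    v.1 = (dMomOne μ M L e (u y) L' e' u' - momTwo μ M L e (u y) * φ') • frameOne i (g y) (h y) +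
        (dMomTwo μ M L e (u y) L' e' u' + momOne μ M L e (u y) * φ') • frameTwo i (g y) (h y) +
        (i' * (momOne μ M L e (u y) * Real.sin (g y) + momTwo μ M L e (u y) * Real.cos (g y)) +
          h' * Real.sin i * (momTwo μ M L e (u y) * Real.sin (g y)
            - momOne μ M L e (u y) * Real.cos (g y))) • frameThree i (h y) ∧
    v.2 = (dPosOne μ M L e (u y) L' e' u' - posTwo μ M L e (u y) * φ') • frameOne i (g y) (h y) +
        (dPosTwo μ M L e (u y) L' e' u' + posOne μ M L e (u y) * φ') • frameTwo i (g y) (h y) +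
        (i' * (posOne μ M L e (u y) * Real.sin (g y) + posTwo μ M L e (u y) * Real.cos (g y)) +
          h' * Real.sin i * (posTwo μ M L e (u y) * Real.sin (g y)
            - posOne μ M L e (u y) * Real.cos (g y))) • frameThree i (h y) := by
  rintro L e i L' e' u' i' φ' h' rfl rfl rfl rfl rfl rfl rfl rfl rfl
  have hyD := hUD hy
  have hc : Continuous fun t : ℝ => y + t • v := by fun_prop
  have hev : ∀ᶠ t in nhds (0 : ℝ), y + t • v ∈ U :=
    hc.continuousAt.preimage_mem_nhds (by simpa using hU.mem_nhds hy)
  have dL := hasDerivAt_along_line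
    ((contDiffAt_varL (n := 1) hμ hM hyD).differentiableAt one_ne_zero) v
  have de := hasDerivAt_along_line ((contDiffAt_ecc (n := 1) hyD).differentiableAt one_ne_zero) v
  have di := hasDerivAt_along_line
    ((contDiffAt_inclination (n := 1) hyD).differentiableAt one_ne_zero) v
  have du := hasDerivAt_along_line hu v
  have dg := hasDerivAt_along_line hg v
  have dh := hasDerivAt_along_line hh v
  have y0 : y + (0 : ℝ) • v = y := by simp
  have hs : 0 < 1 - ecc μ M (y + (0 : ℝ) • v) ^ 2 := by
    rw [y0]; exact one_sub_ecc_sq_pos hμ hM hyD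
  have hL : varL μ M (y + (0 : ℝ) • v) ≠ 0 := by
    rw [y0]; exact (varL_pos hμ hM hyD).ne'
  have hd : 1 - ecc μ M (y + (0 : ℝ) • v) * Real.cos (u (y + (0 : ℝ) • v)) ≠ 0 := by
    rw [y0]
    exact (one_sub_mul_cos_pos (ecc_pos_of_mem hyD) (ecc_lt_one hμ hM hyD) _).ne'
  have hline : HasDerivAt (fun t : ℝ => y + t • v) v 0 := by
    simpa using ((hasDerivAt_id (0 : ℝ)).smul_const v).const_add y
  constructor
  · have h1 := hasDerivAt_frame_combination (hasDerivAt_momOne (μ := μ) (M := M) dL de du hL hd)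
      (hasDerivAt_momTwo (μ := μ) (M := M) dL de du hL hd hs) di dg dh
    simp only [y0] at h1
    have h2 : HasDerivAt (fun t : ℝ => (y + t • v).1) v.1 0 := by
      have := (hasFDerivAt_fst (𝕜 := ℝ) (p := y + (0 : ℝ) • v)).comp_hasDerivAt (0 : ℝ) hline
      exact this
    -- Along the line y + t v the momentum has derivative v.1, and for small t, while the line stays
    -- in U, it equals the reconstruction formula.
    refine h2.unique (h1.congr_of_eventuallyEq ?_)
    filter_upwards [hev] with t ht
    obtain ⟨a, b, c⟩ := hlift _ ht
    exact mom_eq_frame hμ hM (hUD ht) a b c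
  · have h1 := hasDerivAt_frame_combination (hasDerivAt_posOne (μ := μ) (M := M) dL de du)
      (hasDerivAt_posTwo (μ := μ) (M := M) dL de du hs) di dg dh
    simp only [y0] at h1
    have h2 : HasDerivAt (fun t : ℝ => (y + t • v).2) v.2 0 := by
      have := (hasFDerivAt_snd (𝕜 := ℝ) (p := y + (0 : ℝ) • v)).comp_hasDerivAt (0 : ℝ) hline
      exact this
    refine h2.unique (h1.congr_of_eventuallyEq ?_)
    filter_upwards [hev] with t ht
    obtain ⟨a, b, c⟩ := hlift _ ht
    exact pos_eq hμ hM (hUD ht) a b c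

lemma fderiv_meanAnomaly {y : Phase} (hy : y ∈ domain μ M) (hu : DifferentiableAt ℝ u y)
    (v : Phase) :
    fderiv ℝ (fun y => u y - ecc μ M y * Real.sin (u y)) y v = fderiv ℝ u y v -
      (fderiv ℝ (ecc μ M) y v * Real.sin (u y) +
        ecc μ M y * (Real.cos (u y) * fderiv ℝ u y v)) := by
  have he := (contDiffAt_ecc (n := 1) hy).differentiableAt one_ne_zero
  have : HasFDerivAt (fun y => u y - ecc μ M y * Real.sin (u y)) _ y :=
    hu.hasFDerivAt.sub (he.hasFDerivAt.mul hu.hasFDerivAt.sin)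
  rw [this.fderiv]
  simp
  ring

lemma fderiv_varH (hμ : 0 < μ) (hM : 0 < M) {y : Phase} (hy : y ∈ domain μ M) (v : Phase) :
    fderiv ℝ (varH μ M) y v = fderiv ℝ (varG μ M) y v * Real.cos (inclination y) -
      varG μ M y * (Real.sin (inclination y) * fderiv ℝ inclination y v) := by
  have hG := (contDiffAt_varG (n := 1) hμ hM hy).differentiableAt one_ne_zero
  have hi := (contDiffAt_inclination (n := 1) hy).differentiableAt one_ne_zero
  have : HasFDerivAt (varH μ M) _ y := hG.hasFDerivAt.mul hi.hasFDerivAt.cos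
  rw [this.fderiv]
  simp
  ring

/-- G is differentiated through `angular_momentum_planar` rather than as L √(1 - e²), to match the
terms of ω that contain the rotation rate. -/
lemma fderiv_varG (hμ : 0 < μ) (hM : 0 < M) {y : Phase} (hy : y ∈ domain μ M)
    (hu : DifferentiableAt ℝ u y) (v : Phase) :
    ∀ {L e L' e' u' : ℝ}, L = varL μ M y → e = ecc μ M y →
      L' = fderiv ℝ (varL μ M) y v → e' = fderiv ℝ (ecc μ M) y v → u' = fderiv ℝ u y v →
    fderiv ℝ (varG μ M) y v =
      dPosOne μ M L e (u y) L' e' u' * momTwo μ M L e (u y)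
        + posOne μ M L e (u y) * dMomTwo μ M L e (u y) L' e' u'
        - dPosTwo μ M L e (u y) L' e' u' * momOne μ M L e (u y)
        - posTwo μ M L e (u y) * dMomOne μ M L e (u y) L' e' u' := by
  rintro L e L' e' u' rfl rfl rfl rfl rfl
  have dL := hasDerivAt_along_line
    ((contDiffAt_varL (n := 1) hμ hM hy).differentiableAt one_ne_zero) v
  have de := hasDerivAt_along_line ((contDiffAt_ecc (n := 1) hy).differentiableAt one_ne_zero) v
  have du := hasDerivAt_along_line hu v
  have dG := hasDerivAt_along_line
    ((contDiffAt_varG (n := 1) hμ hM hy).differentiableAt one_ne_zero) v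
  have y0 : y + (0 : ℝ) • v = y := by simp
  have hs : 0 < 1 - ecc μ M (y + (0 : ℝ) • v) ^ 2 := by
    rw [y0]; exact one_sub_ecc_sq_pos hμ hM hy
  have hL : varL μ M (y + (0 : ℝ) • v) ≠ 0 := by
    rw [y0]; exact (varL_pos hμ hM hy).ne'
  have hd : 1 - ecc μ M (y + (0 : ℝ) • v) * Real.cos (u (y + (0 : ℝ) • v)) ≠ 0 := by
    rw [y0]
    exact (one_sub_mul_cos_pos (ecc_pos_of_mem hy) (ecc_lt_one hμ hM hy) _).ne'
  have h1 := ((hasDerivAt_posOne (μ := μ) (M := M) dL de du).mul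
    (hasDerivAt_momTwo (μ := μ) (M := M) dL de du hL hd hs)).sub
    ((hasDerivAt_posTwo (μ := μ) (M := M) dL de du hs).mul
      (hasDerivAt_momOne (μ := μ) (M := M) dL de du hL hd))
  simp only [y0] at h1
  have hc : Continuous fun t : ℝ => y + t • v := by fun_prop
  have hev : ∀ᶠ t in nhds (0 : ℝ), y + t • v ∈ domain μ M :=
    hc.continuousAt.preimage_mem_nhds (by simpa using (isOpen_domain μ M).mem_nhds hy)
  refine (dG.unique (h1.congr_of_eventuallyEq ?_)).trans (by ring)
  filter_upwards [hev] with t ht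
  exact (angular_momentum_planar hμ hM (varL_pos hμ hM ht) (ecc_pos_of_mem ht)
    (ecc_lt_one hμ hM ht)).symm

/-- The Delaunay variables are canonical. -/
theorem omega_eq_wedge (hμ : 0 < μ) (hM : 0 < M) (hU : IsOpen U) (hUD : U ⊆ domain μ M)
    (hlift : ∀ y ∈ U, (u y : Real.Angle) = eccAnomaly μ M y ∧ (g y : Real.Angle) = varg μ M y ∧
      (h y : Real.Angle) = varh y) {y : Phase} (hy : y ∈ U) (hu : DifferentiableAt ℝ u y)
    (hg : DifferentiableAt ℝ g y) (hh : DifferentiableAt ℝ h y) (v w : Phase) :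
    omega v w =
      wedge (fderiv ℝ (varL μ M) y) (fderiv ℝ (fun y => u y - ecc μ M y * Real.sin (u y)) y) v w +
      wedge (fderiv ℝ (varG μ M) y) (fderiv ℝ g y) v w +
      wedge (fderiv ℝ (varH μ M) y) (fderiv ℝ h y) v w := by
  have hyD := hUD hy
  have hv := @tangent_eq μ M U u g h hμ hM hU hUD hlift y hy hu hg hh v _ _ _ _ _ _ _ _ _
    rfl rfl rfl rfl rfl rfl rfl rfl rfl
  have hw := @tangent_eq μ M U u g h hμ hM hU hUD hlift y hy hu hg hh w _ _ _ _ _ _ _ _ _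
    rfl rfl rfl rfl rfl rfl rfl rfl rfl
  have hplane := planar_form hμ hM (u := u y) (varL_pos hμ hM hyD) (ecc_pos_of_mem hyD)
    (ecc_lt_one hμ hM hyD) (fderiv ℝ (varL μ M) y v) (fderiv ℝ (ecc μ M) y v) (fderiv ℝ u y v)
    (fderiv ℝ (varL μ M) y w) (fderiv ℝ (ecc μ M) y w) (fderiv ℝ u y w)
  have hG : varG μ M y = _ := (angular_momentum_planar hμ hM (u := u y) (varL_pos hμ hM hyD)
    (ecc_pos_of_mem hyD) (ecc_lt_one hμ hM hyD)).symm
  have hsc := Real.sin_sq_add_cos_sq (g y)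
  rw [omega_eq_inner, hv.1, hv.2, hw.1, hw.2, inner_frame, inner_frame]
  simp only [wedge, fderiv_meanAnomaly hyD hu, fderiv_varH hμ hM hyD]
  rw [← hplane, hG, fderiv_varG hμ hM hyD hu v rfl rfl rfl rfl rfl,
    fderiv_varG hμ hM hyD hu w rfl rfl rfl rfl rfl]
  -- The rotation terms already match dG ∧ (dg + cos i dh). The normal components leave -G sin i di
  -- ∧ dh multiplied by sin² g + cos² g.
  linear_combination (Real.sin (inclination y) *
    (momOne μ M (varL μ M y) (ecc μ M y) (u y) * posTwo μ M (varL μ M y) (ecc μ M y) (u y)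
      - momTwo μ M (varL μ M y) (ecc μ M y) (u y) * posOne μ M (varL μ M y) (ecc μ M y) (u y)) *
    (fderiv ℝ inclination y v * fderiv ℝ h y w - fderiv ℝ inclination y w * fderiv ℝ h y v)) * hsc

end Form

/-! ### Nondegeneracy and local charts -/

lemma eq_zero_of_omega_eq_zero {v : Phase} (hv : ∀ w, omega v w = 0) : v = 0 := by
  have h1 : ‖v.1‖ ^ 2 = 0 := by
    simpa [omega_eq_inner] using hv (0, v.1)
  have h2 : ‖v.2‖ ^ 2 = 0 := by
    simpa [omega_eq_inner] using hv (v.2, 0)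
  exact Prod.ext (by simpa using h1) (by simpa using h2)

/-- A smooth map between spaces of the same finite dimension, with injective differentials on an
open set, restricts to a smooth chart near each point of it. -/
lemma exists_isSmoothChart {V W : Type*} [NormedAddCommGroup V] [NormedSpace ℝ V]
    [FiniteDimensional ℝ V] [NormedAddCommGroup W] [NormedSpace ℝ W] [FiniteDimensional ℝ W]
    (hVW : Module.finrank ℝ V = Module.finrank ℝ W) {f : V → W} {U : Set V} (hU : IsOpen U)
    (hf : ∀ y ∈ U, ContDiffAt ℝ ∞ f y) (hinj : ∀ y ∈ U, Function.Injective (fderiv ℝ f y))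
    {x : V} (hx : x ∈ U) :
    ∃ U' : Set V, IsOpen U' ∧ x ∈ U' ∧ U' ⊆ U ∧ IsSmoothChart f U' := by
  have : CompleteSpace V := FiniteDimensional.complete ℝ V
  have hder : ∀ y ∈ U, ∃ A : V ≃L[ℝ] W, HasFDerivAt f (A : V →L[ℝ] W) y := by
    intro y hy
    refine ⟨(LinearEquiv.ofInjectiveOfFinrankEq (fderiv ℝ f y : V →ₗ[ℝ] W) (hinj y hy)
      hVW).toContinuousLinearEquiv, ?_⟩
    refine ((hf y hy).differentiableAt (by simp)).hasFDerivAt.congr_fderiv ?_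
    ext v
    rfl
  obtain ⟨A, hA⟩ := hder x hx
  -- Restricting to U keeps the differential invertible at every point of the source, so the inverse
  -- is smooth on the whole target and not only at the image of x.
  let φ := ((hf x hx).toOpenPartialHomeomorph f hA (by simp)).restrOpen U hU
  have hφ : ∀ y, φ y = f y := fun y => rfl
  have hsub : φ.source ⊆ U := fun y hy => hy.2
  refine ⟨φ.source, φ.open_source,
    ⟨(hf x hx).mem_toOpenPartialHomeomorph_source hA (by simp), hx⟩, hsub,
    φ, rfl, fun y _ => hφ y, fun y hy => (hf y (hsub hy)).contDiffWithinAt, ?_⟩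
  intro z hz
  have hy := hsub (φ.map_target hz)
  obtain ⟨B, hB⟩ := hder _ hy
  exact (φ.contDiffAt_symm hz hB (hf _ hy)).contDiffWithinAt

theorem exists_isDarbouxOn {μ M : ℝ} (hμ : 0 < μ) (hM : 0 < M) {x : Phase}
    (hx : x ∈ domain μ M) :
    ∃ (U : Set Phase) (l g h : Phase → ℝ),
      IsOpen U ∧ x ∈ U ∧ U ⊆ domain μ M ∧ IsDarbouxOn μ M U l g h := by
  obtain ⟨U, u, g, h, hU, hxU, hUD, hsm, hlift⟩ := exists_smooth_lifts hμ hM hx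
  have hdiff : ∀ {f : Phase → ℝ} {y : Phase}, ContDiffAt ℝ ∞ f y → DifferentiableAt ℝ f y :=
    fun hf => hf.differentiableAt (by simp)
  set l : Phase → ℝ := fun y => u y - ecc μ M y * Real.sin (u y) with hl
  have hform : ∀ y ∈ U, ∀ v w : Phase, omega v w =
      wedge (fderiv ℝ (varL μ M) y) (fderiv ℝ l y) v w +
      wedge (fderiv ℝ (varG μ M) y) (fderiv ℝ g y) v w +
      wedge (fderiv ℝ (varH μ M) y) (fderiv ℝ h y) v w := fun y hy v w =>
    omega_eq_wedge hμ hM hU hUD hlift hy (hdiff (hsm y hy).1) (hdiff (hsm y hy).2.1)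
      (hdiff (hsm y hy).2.2) v w
  have hF : ∀ y ∈ U, ContDiffAt ℝ ∞
      (fun y => ![varL μ M y, l y, varG μ M y, g y, varH μ M y, h y]) y := by
    intro y hy
    have hyD := hUD hy
    obtain ⟨h1, h2, h3⟩ := hsm y hy
    rw [contDiffAt_pi]
    intro j
    fin_cases j
    · exact contDiffAt_varL hμ hM hyD
    · exact h1.sub ((contDiffAt_ecc hyD).mul h1.sin)
    · exact contDiffAt_varG hμ hM hyD
    · exact h2
    · exact contDiffAt_varH hμ hM hyD
    · exact h3
  have hinj : ∀ y ∈ U, Function.Injective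
      (fderiv ℝ (fun y => ![varL μ M y, l y, varG μ M y, g y, varH μ M y, h y]) y) := by
    intro y hy
    have hFd := (hF y hy).differentiableAt (by simp)
    rw [injective_iff_map_eq_zero]
    intro v hv
    have hcoord : ∀ j : Fin 6,
        fderiv ℝ (fun y => ![varL μ M y, l y, varG μ M y, g y, varH μ M y, h y] j) y v = 0 := by
      intro j
      have := (hasFDerivAt_pi'.1 hFd.hasFDerivAt j).fderiv
      rw [this]
      simp [hv]
    -- All six differentials vanish on v, so each wedge in the formula for ω(v, w) vanishes.
    refine eq_zero_of_omega_eq_zero fun w => ?_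
    have c0 : fderiv ℝ (varL μ M) y v = 0 := hcoord 0
    have c1 : fderiv ℝ l y v = 0 := hcoord 1
    have c2 : fderiv ℝ (varG μ M) y v = 0 := hcoord 2
    have c3 : fderiv ℝ g y v = 0 := hcoord 3
    have c4 : fderiv ℝ (varH μ M) y v = 0 := hcoord 4
    have c5 : fderiv ℝ h y v = 0 := hcoord 5
    rw [hform y hy]
    simp [wedge, c0, c1, c2, c3, c4, c5]
  obtain ⟨U', hU', hxU', hsub, hchart⟩ := exists_isSmoothChart (by simp) hU hF hinj hxU
  refine ⟨U', l, g, h, hU', hxU', hsub.trans hUD, ?_, ?_, ?_, hchart, ?_⟩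
  · intro y hy
    have h1 := (hlift y (hsub hy)).1
    rw [varl, ← h1, Real.Angle.sin_coe, ← Real.Angle.coe_sub]
  · exact fun y hy => (hlift y (hsub hy)).2.1
  · exact fun y hy => (hlift y (hsub hy)).2.2
  · exact fun y hy => hform y (hsub hy)

end Delaunay

end

theorem mainTheorem3 (μ M : ℝ) (hμ : 0 < μ) (hM : 0 < M) :
    IsOpen (Delaunay.domain μ M) ∧
    Delaunay.domain μ M ⊆ Delaunay.elliptic μ M ∧
    Delaunay.elliptic μ M ⊆ closure (Delaunay.domain μ M) ∧
    Set.InjOn (Delaunay.coords μ M) (Delaunay.domain μ M) ∧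
    ∀ x ∈ Delaunay.domain μ M, ∃ (U : Set Delaunay.Phase) (l g h : Delaunay.Phase → ℝ),
      IsOpen U ∧ x ∈ U ∧ U ⊆ Delaunay.domain μ M ∧ Delaunay.IsDarbouxOn μ M U l g h :=
  ⟨Delaunay.isOpen_domain μ M, fun _ hx => hx.1, Delaunay.elliptic_subset_closure_domain,
    Delaunay.coords_injOn hμ hM, fun _ hx => Delaunay.exists_isDarbouxOn hμ hM hx⟩
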